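/- Let $X$ be a countable discrete set, $m:X\to(0,\infty)$ a function, regarded as a measure by $m(A)=\sum_{x\in A}m(x)$, and let $b:X\times X\to[0,\infty)$ be symmetric with $b(x,x)=0$ and $\sum_{y\in X}b(x,y)<\infty$ for all $x\in X$. Write $x\sim y$ if $b(x,y)>0$, and call $b$ connected if any two points of $X$ are joined by a finite path $x_0\sim x_1\sim\dots\sim x_n$. On the real Hilbert space $\ell^2(X,m)$ consider the maximal form $$\mathcal E^{\max}(u,v)=\frac12\sum_{x,y\in X}b(x,y)(u(x)-u(y))(v(x)-v(y)),\qquad D^{\max}=\Big\{u\in\ell^2(X,m)\ \Big|\ \frac12\sum_{x,y\in X}b(x,y)(u(x)-u(y))^2<\infty\Big\},$$ and let $L^{\max}$ be the positive self-adjoint operator arising from it, that is, $u\in D^{\max}$ lies in its domain with $L^{\max}u=w$ if and only if $\mathcal E^{\max}(u,v)=\langle w,v\rangle$ for all $v\in D^{\max}$. Let $\lambda_0(L^{\max})=\inf\sigma(L^{\max})$ and $\lambda_0^{\mathrm{ess}}(L^{\max})=\inf\sigma_{\mathrm{ess}}(L^{\max})$ (with $\inf\emptyset=\infty$) be the bottoms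 of the spectrum and of the essential spectrum. Let $\rho:X\times X\to[0,\infty)$ be an intrinsic pseudo metric, that is, a pseudo metric with $\frac12\sum_{y\in X}b(x,y)\rho(x,y)^2\le m(x)$ for all $x\in X$. Put $B_r(x)=\{y\in X\mid\rho(x,y)\le r\}$, fix $x_0\in X$, and let $$\mu=\liminf_{r\to\infty}\frac1r\log m(B_r(x_0)),\qquad \tilde\mu=\liminf_{r\to\infty}\frac1r\inf_{x\in X}\log\frac{m(B_r(x))}{m(B_1(x))}$$ in $[0,\infty]$, where $\infty/\infty$ is read as $\infty$. Assume that $b$ is connected and $m(X)=\infty$. Then $$\lambda_0(L^{\max})\le\frac{\tilde\mu^2}{4}\quad\text{and}\quad\lambda_0^{\mathrm{ess}}(L^{\max})\le\frac{\mu^2}{4}.$$ If moreover $0\le\delta\le1$ and $\rho(x,y)\in[\delta,1]$ for all $x\sim y$, then $$\lambda_0(L^{\max})\le\frac{2(e^{\tilde\mu/2}-1)^2}{\delta^2e^{\tilde\mu}+1}\quad\text{and}\quad\lambda_0^{\mathrm{ess}}(L^{\max})\le\frac{2(e^{\mu/2}-1)^2}{\delta^2e^{\mu}+1},$$ where for $\tilde\mu=\infty$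 (respectively $\mu=\infty$) the right-hand side is understood as its limit, i.e. $2/\delta^2$ if $\delta>0$ and $\infty$ if $\delta=0$. -/

import Mathlib

open MeasureTheory Filter Topology
open scoped ENNReal NNReal

noncomputable section

/-! ### Operators of forms and their spectra on a real Hilbert space -/

section HilbertSpace

variable {H : Type*} [NormedAddCommGroup H] [InnerProductSpace ℝ H]

/-- The graph `{(u, w) | u ∈ D, E(u, v) = ⟪w, v⟫ for all v ∈ D}` of the operator arising from a
bilinear form `E` with domain `D`. -/
def formGraph (D : Submodule ℝ H) (E : D →ₗ[ℝ] D →ₗ[ℝ] ℝ) : Submodule ℝ (H × H) where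
  carrier := {p | ∃ u : D, (u : H) = p.1 ∧ ∀ v : D, E u v = inner ℝ p.2 (v : H)}
  zero_mem' := ⟨0, rfl, fun v => by simp⟩
  add_mem' := by
    rintro p q ⟨u, hu, hu'⟩ ⟨w, hw, hw'⟩
    exact ⟨u + w, by simp [hu, hw], fun v => by simp [hu', hw', inner_add_left]⟩
  smul_mem' := by
    rintro c p ⟨u, hu, hu'⟩
    exact ⟨c • u, by simp [hu], fun v => by simp [hu', inner_smul_left]⟩

/-- The operator arising from a form `E` with (dense) domain `D`: a vector `u` of `D` is in the
domain of the operator and is mapped to `w` if and only if `E(u, v) = ⟪w, v⟫` for all `v ∈ D`. -/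
def formOperator (D : Submodule ℝ H) (E : D →ₗ[ℝ] D →ₗ[ℝ] ℝ) : H →ₗ.[ℝ] H :=
  (formGraph D E).toLinearPMap

/-- If `D` is dense, then the operator really has the prescribed graph. -/
theorem formOperator_graph {D : Submodule ℝ H} (hD : Dense (D : Set H))
    (E : D →ₗ[ℝ] D →ₗ[ℝ] ℝ) : (formOperator D E).graph = formGraph D E := by
  refine Submodule.toLinearPMap_graph_eq _ ?_
  rintro p ⟨u, hu, hu'⟩ hp
  have hu0 : u = 0 := by
    apply Subtype.ext
    rw [hu, hp]
    rfl
  refine hD.eq_zero_of_inner_left (𝕜 := ℝ) fun v hv => ?_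
  rw [← hu' ⟨v, hv⟩, hu0]
  simp

/-- The linear map `T - lam` on the domain of a (possibly unbounded) operator `T`. -/
def shiftedOp (T : H →ₗ.[ℝ] H) (lam : ℝ) : T.domain →ₗ[ℝ] H :=
  T.toFun - lam • T.domain.subtype

/-- The (real) spectrum: the complement of the set of those `lam` for which
`T - lam : D(T) → H` is bijective with bounded inverse `R`. -/
def opSpectrum (T : H →ₗ.[ℝ] H) : Set ℝ :=
  {lam | ¬ ∃ R : H →L[ℝ] H, (∀ u : T.domain, R (shiftedOp T lam u) = u) ∧
    ∀ f : H, ∃ u : T.domain, (u : H) = R f ∧ shiftedOp T lam u = f}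

/-- The essential spectrum: the set of those `lam` for which `T - lam` is not a Fredholm operator,
where an operator is Fredholm if its kernel is finite dimensional and its range is closed and has
finite codimension. -/
def opEssSpectrum (T : H →ₗ.[ℝ] H) : Set ℝ :=
  {lam | ¬ (FiniteDimensional ℝ (LinearMap.ker (shiftedOp T lam)) ∧
    IsClosed (LinearMap.range (shiftedOp T lam) : Set H) ∧
    FiniteDimensional ℝ (H ⧸ LinearMap.range (shiftedOp T lam)))}

/-- The bottom of the spectrum, in `[-∞, ∞]`. -/
def specBottom (T : H →ₗ.[ℝ] H) : EReal :=
  sInf ((fun t : ℝ => (t : EReal)) '' opSpectrum T)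

/-- The bottom of the essential spectrum, in `[-∞, ∞]`; it is `∞` if the essential spectrum is
empty. -/
def essSpecBottom (T : H →ₗ.[ℝ] H) : EReal :=
  sInf ((fun t : ℝ => (t : EReal)) '' opEssSpectrum T)

end HilbertSpace

/-! ### Weighted graphs -/

/-- A weighted graph `b` over a discrete measure space `(X, m)`, where `m` is a measure of full
support that is finite on points (that is, on compact sets). -/
structure WeightedGraph (X : Type*) [MeasurableSpace X] where
  /-- the measure -/
  m : Measure X
  m_pos : ∀ x, 0 < m {x}
  m_lt_top : ∀ x, m {x} < ∞
  /-- the edge weights -/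
  b : X → X → ℝ≥0
  b_symm : ∀ x y, b x y = b y x
  b_diag : ∀ x, b x x = 0
  b_summable : ∀ x, Summable (b x)

namespace WeightedGraph

variable {X : Type*} [MeasurableSpace X] (G : WeightedGraph X)

/-- The vertices `x`, `y` are connected by an edge if `b(x, y) > 0`. -/
def toSimpleGraph : SimpleGraph X where
  Adj x y := 0 < G.b x y
  symm := ⟨fun x y h => by rw [G.b_symm]; exact h⟩
  loopless := ⟨fun x h => by simp [G.b_diag] at h⟩

/-- The Hilbert space `ℓ²(X, m)` of real-valued square summable functions. -/
abbrev L2 : Type _ := Lp ℝ 2 G.m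

/-- The energy `(1/2) ∑_{x,y} b(x,y) (u(x) - u(y))²` in `[0, ∞]` of a function. -/
def energy (u : X → ℝ) : ℝ≥0∞ :=
  2⁻¹ * ∑' p : X × X, (G.b p.1 p.2 : ℝ≥0∞) * ENNReal.ofReal ((u p.1 - u p.2) ^ 2)

theorem eq_of_ae {u v : X → ℝ} (h : u =ᵐ[G.m] v) : u = v := by
  funext x
  by_contra hx
  have h0 : G.m {y | ¬ u y = v y} = 0 := h
  exact (G.m_pos x).ne' (measure_mono_null (by simpa using hx) h0)

theorem coe_add (u v : G.L2) : ((u + v : G.L2) : X → ℝ) = u + v := G.eq_of_ae (Lp.coeFn_add u v)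

theorem coe_smul (c : ℝ) (u : G.L2) : ((c • u : G.L2) : X → ℝ) = c • (u : X → ℝ) :=
  G.eq_of_ae (Lp.coeFn_smul c u)

theorem coe_zero : ((0 : G.L2) : X → ℝ) = 0 := G.eq_of_ae (Lp.coeFn_zero ℝ 2 G.m)

theorem energy_lt_top_iff (u : X → ℝ) : G.energy u < ∞ ↔
    Summable fun p : X × X => (G.b p.1 p.2 : ℝ) * (u p.1 - u p.2) ^ 2 := by
  have h : ∀ p : X × X, (G.b p.1 p.2 : ℝ≥0∞) * ENNReal.ofReal ((u p.1 - u p.2) ^ 2) =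
      ENNReal.ofReal ((G.b p.1 p.2 : ℝ) * (u p.1 - u p.2) ^ 2) := fun p => by
    rw [ENNReal.ofReal_mul (NNReal.coe_nonneg _), ENNReal.ofReal_coe_nnreal]
  have h0 : ∀ p : X × X, 0 ≤ (G.b p.1 p.2 : ℝ) * (u p.1 - u p.2) ^ 2 := fun p => by positivity
  unfold energy
  simp_rw [h]
  constructor
  · intro hlt
    have h1 : ∑' p : X × X, ENNReal.ofReal ((G.b p.1 p.2 : ℝ) * (u p.1 - u p.2) ^ 2) ≠ ∞ := by
      intro htop
      rw [htop] at hlt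
      simp [ENNReal.mul_top] at hlt
    refine (ENNReal.summable_toReal h1).congr fun p => ?_
    rw [ENNReal.toReal_ofReal (h0 p)]
  · intro hs
    rw [← ENNReal.ofReal_tsum_of_nonneg h0 hs]
    exact ENNReal.mul_lt_top (by simp) ENNReal.ofReal_lt_top

/-- The maximal form domain `D^max = {u ∈ ℓ²(X, m) | energy u < ∞}`. -/
def maxDomain : Submodule ℝ G.L2 where
  carrier := {u | G.energy u < ∞}
  zero_mem' := by
    change G.energy ((0 : G.L2) : X → ℝ) < ∞
    rw [energy_lt_top_iff, coe_zero]
    simp [summable_zero]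
  add_mem' := by
    intro u v hu hv
    rw [Set.mem_ofPred_eq, energy_lt_top_iff] at *
    rw [coe_add]
    refine Summable.of_nonneg_of_le (fun p => by positivity) (fun p => ?_)
      ((hu.add hv).mul_left 2)
    have hb : (0 : ℝ) ≤ G.b p.1 p.2 := NNReal.coe_nonneg _
    simp only [Pi.add_apply]
    nlinarith [mul_nonneg hb (sq_nonneg ((u p.1 - u p.2) - (v p.1 - v p.2)))]
  smul_mem' := by
    intro c u hu
    rw [Set.mem_ofPred_eq, energy_lt_top_iff] at *
    rw [coe_smul]
    refine (hu.mul_left (c ^ 2)).congr fun p => ?_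
    simp only [Pi.smul_apply, smul_eq_mul]
    ring

theorem summable_maxForm (u v : G.maxDomain) : Summable fun p : X × X =>
    (G.b p.1 p.2 : ℝ) * ((u : G.L2) p.1 - (u : G.L2) p.2) *
      ((v : G.L2) p.1 - (v : G.L2) p.2) := by
  have hu := (G.energy_lt_top_iff _).1 u.2
  have hv := (G.energy_lt_top_iff _).1 v.2
  refine Summable.of_norm_bounded (hu.add hv) fun p => ?_
  have hb : (0 : ℝ) ≤ G.b p.1 p.2 := NNReal.coe_nonneg _
  rw [Real.norm_eq_abs, abs_le]
  constructor <;>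
  nlinarith [mul_nonneg hb (sq_nonneg (((u : G.L2) p.1 - (u : G.L2) p.2) -
      ((v : G.L2) p.1 - (v : G.L2) p.2))),
    mul_nonneg hb (sq_nonneg (((u : G.L2) p.1 - (u : G.L2) p.2) +
      ((v : G.L2) p.1 - (v : G.L2) p.2))),
    mul_nonneg hb (sq_nonneg ((u : G.L2) p.1 - (u : G.L2) p.2)),
    mul_nonneg hb (sq_nonneg ((v : G.L2) p.1 - (v : G.L2) p.2))]

/-- The maximal form `E^max(u, v) = (1/2) ∑_{x,y} b(x,y) (u(x) - u(y)) (v(x) - v(y))` on its domain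
`D^max`. -/
def maxForm : G.maxDomain →ₗ[ℝ] G.maxDomain →ₗ[ℝ] ℝ :=
  LinearMap.mk₂ ℝ
    (fun u v => 2⁻¹ * ∑' p : X × X, (G.b p.1 p.2 : ℝ) *
      ((u : G.L2) p.1 - (u : G.L2) p.2) * ((v : G.L2) p.1 - (v : G.L2) p.2))
    (fun u u' v => by
      rw [← mul_add, ← (G.summable_maxForm u v).tsum_add (G.summable_maxForm u' v)]
      congr 1
      refine tsum_congr fun p => ?_
      rw [Submodule.coe_add, coe_add]
      simp only [Pi.add_apply]
      ring)
    (fun c u v => by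
      rw [smul_eq_mul, mul_left_comm c, ← tsum_mul_left (a := c)]
      congr 1
      refine tsum_congr fun p => ?_
      rw [Submodule.coe_smul, coe_smul]
      simp only [Pi.smul_apply, smul_eq_mul]
      ring)
    (fun u v v' => by
      rw [← mul_add, ← (G.summable_maxForm u v).tsum_add (G.summable_maxForm u v')]
      congr 1
      refine tsum_congr fun p => ?_
      rw [Submodule.coe_add, coe_add]
      simp only [Pi.add_apply]
      ring)
    (fun c u v => by
      rw [smul_eq_mul, mul_left_comm c, ← tsum_mul_left (a := c)]
      congr 1
      refine tsum_congr fun p => ?_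
      rw [Submodule.coe_smul, coe_smul]
      simp only [Pi.smul_apply, smul_eq_mul]
      ring)

/-- The indicator function of a vertex as an element of `ℓ²(X, m)`. -/
def single [DiscreteMeasurableSpace X] (x : X) : G.L2 :=
  indicatorConstLp 2 (MeasurableSet.of_discrete (s := {x})) (G.m_lt_top x).ne (1 : ℝ)

theorem single_mem [DiscreteMeasurableSpace X] (x : X) : G.single x ∈ G.maxDomain := by
  classical
  change G.energy (G.single x : X → ℝ) < ∞
  have h : ((G.single x : G.L2) : X → ℝ) = ({x} : Set X).indicator fun _ => (1 : ℝ) :=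
    G.eq_of_ae indicatorConstLp_coeFn
  rw [h, energy_lt_top_iff]
  have hb : Summable fun y => (G.b x y : ℝ) := NNReal.summable_coe.2 (G.b_summable x)
  have h1 : Summable fun p : X × X => if p.1 = x then (G.b p.1 p.2 : ℝ) else 0 := by
    have hi : Function.Injective fun y : X => (x, y) := fun y z hyz => (Prod.ext_iff.1 hyz).2
    refine (hi.summable_iff fun p hp => ?_).1 (hb.congr fun y => by simp)
    refine if_neg fun hpx => hp ⟨p.2, ?_⟩
    rw [← hpx]
  have h2 : Summable fun p : X × X => if p.2 = x then (G.b p.1 p.2 : ℝ) else 0 := by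
    refine ((Equiv.prodComm X X).summable_iff.2 h1).congr fun p => ?_
    simp [G.b_symm p.2 p.1]
  refine Summable.of_nonneg_of_le (fun p => by positivity) (fun p => ?_) (h1.add h2)
  have hbp : (0 : ℝ) ≤ G.b p.1 p.2 := NNReal.coe_nonneg _
  by_cases hx1 : p.1 = x <;> by_cases hx2 : p.2 = x <;>
    simp [Set.indicator, hx1, hx2]

/-- The domain of the maximal form is dense. -/
theorem dense_maxDomain [Countable X] [DiscreteMeasurableSpace X] :
    Dense (G.maxDomain : Set G.L2) := by
  rw [Submodule.dense_iff_topologicalClosure_eq_top, Submodule.topologicalClosure_eq_top_iff,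
    Submodule.eq_bot_iff]
  intro u hu
  have h0 : (u : X → ℝ) = 0 := by
    funext x
    have hx := (Submodule.mem_orthogonal _ _).1 hu _ (G.single_mem x)
    rw [single, L2.inner_indicatorConstLp_one, Measure.restrict_singleton,
      integral_smul_measure, integral_dirac, smul_eq_mul] at hx
    exact (mul_eq_zero.1 hx).resolve_left
      (ENNReal.toReal_pos (G.m_pos x).ne' (G.m_lt_top x).ne).ne'
  apply Lp.ext
  rw [h0, coe_zero]

/-- The operator `L^max` arising from the maximal form. -/
def Lmax : G.L2 →ₗ.[ℝ] G.L2 := formOperator G.maxDomain G.maxForm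

/-! ### Intrinsic metrics and volume growth -/

/-- A pseudo metric `ρ` with values in `[0, ∞)` is intrinsic if
`(1/2) ∑_y b(x,y) ρ(x,y)² ≤ m(x)` for all vertices `x`. -/
def IsIntrinsic (ρ : PseudoMetric X ℝ) : Prop :=
  ∀ x, 2⁻¹ * ∑' y, (G.b x y : ℝ≥0∞) * ENNReal.ofReal (ρ x y ^ 2) ≤ G.m {x}

/-- The volume `m(B_r(x))` of the distance ball `B_r(x) = {y | ρ(y, x) ≤ r}`. -/
def vol (ρ : PseudoMetric X ℝ) (x : X) (r : ℝ) : ℝ≥0∞ := G.m {y | ρ y x ≤ r}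

/-- The exponential volume growth `μ = liminf_{r → ∞} (1/r) log m(B_r(x₀))`, in `[-∞, ∞]`. -/
def volGrowth (ρ : PseudoMetric X ℝ) (x₀ : X) : EReal :=
  liminf (fun r : ℝ => ENNReal.log (G.vol ρ x₀ r) / (r : EReal)) atTop

/-- The minimal exponential volume growth
`liminf_{r → ∞} (1/r) inf_x log (m(B_r(x)) / m(B_1(x)))`, in `[-∞, ∞]`. The infimum is over those
`x` for which the ball `B_1(x)` has finite volume. (For the other `x` and `r ≥ 1` the quotient is
`∞ / ∞`, which is read as `∞`.) -/
def minVolGrowth (ρ : PseudoMetric X ℝ) : EReal :=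
  liminf (fun r : ℝ => (⨅ (x : X) (_ : G.vol ρ x 1 < ∞),
    ENNReal.log (G.vol ρ x r / G.vol ρ x 1)) / (r : EReal)) atTop

end WeightedGraph

/-- The bound `2 (e^{s/2} - 1)² / (δ² e^s + 1)` as a function of `s ∈ [0, ∞]`. The value at
`s = ∞` is the limit for `s → ∞`, that is `2 / δ²` if `δ ≠ 0` and `∞` if `δ = 0`. -/
def jumpBound (δ : ℝ) (s : EReal) : EReal :=
  if s = ⊤ then (if δ = 0 then ⊤ else ((2 / δ ^ 2 : ℝ) : EReal))
  else ((2 * (Real.exp (s.toReal / 2) - 1) ^ 2 / (δ ^ 2 * Real.exp s.toReal + 1) : ℝ) : EReal)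

end

/-! Both bounds come from test functions that decay exponentially in the intrinsic metric. With `α`
slightly above half the growth rate, take `f = exp(-α ρ(·,x))`, frozen inside a ball of radius `r₁`
and outside one of radius `r`, minus its outer value (`cutoffExp`). An edge of length `t` costs at
most `K t²` times the sum of the squared values of the exponential at its ends. Here `K = α²/2`
works in general (`exp_sub_one_sq_le`), and a smaller `K` works when `t ∈ [δ,1]`
(`exp_mul_sub_one_sq_le`). The intrinsic condition turns this into `energy f ≤ 2K ‖f‖²` up to an
error of order `exp(-2αr) m(B_r)`, which is negligible as soon as `m(B_r)/m(B_{r₁})` is small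
against `exp(2α(r - r₁))` (`energy_cutoffExp_le_mul_sqNorm`).

For `λ₀` one takes `r₁ = 1` and a centre that nearly realizes the infimum in `minVolGrowth`. For
`λ₀^ess` the centre stays fixed and `r₁ = R`, `r = 2R` with `R → ∞` along good radii
(`exists_vol_two_mul_le`); since `m(X) = ∞`, the normalized functions tend weakly to zero. Finally
`α` decreases to half the growth rate. If the growth is infinite and `δ > 0`, indicators of points
give `2/δ²`.

The link to the spectrum is `exists_mem_opSpectrum_le` and `exists_mem_opEssSpectrum_le`. Both are
proved from the definitions, by showing that the best (asymptotic) lower bound of the form could be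
improved if it were a regular, respectively Fredholm, point. -/

noncomputable section

/-! ### Spectral bottoms from Rayleigh quotients. -/

section HilbertSpace

variable {H : Type*} [NormedAddCommGroup H] [InnerProductSpace ℝ H]

theorem formOperator_apply {D : Submodule ℝ H} (hD : Dense (D : Set H))
    (E : D →ₗ[ℝ] D →ₗ[ℝ] ℝ) (u : (formOperator D E).domain) :
    ∃ h : (u : H) ∈ D, ∀ v : D, E ⟨u, h⟩ v = inner ℝ (formOperator D E u) (v : H) := by
  have h := (formOperator D E).mem_graph u
  rw [formOperator_graph hD] at h
  obtain ⟨u', hu, hv⟩ := h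
  have hu' : (u : H) ∈ D := by
    have : (u' : H) = u := hu
    rw [← this]
    exact u'.2
  refine ⟨hu', fun v => ?_⟩
  have : (⟨u, hu'⟩ : D) = u' := Subtype.ext hu.symm
  rw [this]
  exact hv v

theorem form_add_smul_self {D : Submodule ℝ H} {E : D →ₗ[ℝ] D →ₗ[ℝ] ℝ}
    (hsymm : ∀ u v, E u v = E v u) (u v : D) (t : ℝ) :
    E (u + t • v) (u + t • v) = E u u + 2 * t * E u v + t ^ 2 * E v v := by
  simp only [map_add, map_smul, LinearMap.add_apply, LinearMap.smul_apply, smul_eq_mul,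
    hsymm v u]
  ring

theorem norm_add_smul_sq (u v : H) (t : ℝ) :
    ‖u + t • v‖ ^ 2 = ‖u‖ ^ 2 + 2 * t * inner ℝ u v + t ^ 2 * ‖v‖ ^ 2 := by
  rw [norm_add_sq_real, norm_smul, inner_smul_right, mul_pow, Real.norm_eq_abs, sq_abs]
  ring

/-- The bottom of the spectrum is at most every Rayleigh quotient. -/
theorem exists_mem_opSpectrum_le {D : Submodule ℝ H} (hD : Dense (D : Set H))
    {E : D →ₗ[ℝ] D →ₗ[ℝ] ℝ} (hsymm : ∀ u v, E u v = E v u) (hnonneg : ∀ u, 0 ≤ E u u)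
    {c : ℝ} {u : D} (hu : u ≠ 0) (huc : E u u ≤ c * ‖(u : H)‖ ^ 2) :
    ∃ s ∈ opSpectrum (formOperator D E), s ≤ c := by
  set S : Set ℝ := {t | ∀ v : D, t * ‖(v : H)‖ ^ 2 ≤ E v v} with hS
  have hS0 : (0 : ℝ) ∈ S := fun v => by simpa using hnonneg v
  have hup : c ∈ upperBounds S := by
    intro t ht
    have h1 := (ht u).trans huc
    have : 0 < ‖(u : H)‖ ^ 2 := by
      have : (u : H) ≠ 0 := fun h => hu (Subtype.ext h)
      positivity
    exact le_of_mul_le_mul_right h1 this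
  have hs : sSup S ∈ S := by
    intro v
    rcases (sq_nonneg ‖(v : H)‖).eq_or_lt with h0 | h0
    · rw [← h0]; simpa using hnonneg v
    · rw [← le_div_iff₀ h0]
      exact csSup_le ⟨0, hS0⟩ fun t ht => (le_div_iff₀ h0).2 (ht v)
  set s := sSup S
  refine ⟨s, ?_, csSup_le ⟨0, hS0⟩ hup⟩
  rintro ⟨R, -, hR⟩
  have hM : 0 < ‖R‖ + 1 := by positivity
  -- A bounded inverse would improve the bound by `τ = (‖R‖ + 1)⁻¹`: for `w = R v`, expanding `(E -
  -- s)(v - τ w) ≥ 0` gives `(E - s)(v) ≥ 2τ ‖v‖² - τ² ⟪v, w⟫ ≥ τ ‖v‖²`.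
  have hmem : s + (‖R‖ + 1)⁻¹ ∈ S := by
    intro v
    obtain ⟨w, hw, hwv⟩ := hR v
    obtain ⟨hwD, hwE⟩ := formOperator_apply hD E w
    set w' : D := ⟨w, hwD⟩
    have hw' : (w' : H) = R v := hw
    have hT : formOperator D E w = (v : H) + s • (w' : H) := by
      have : formOperator D E w - s • (w : H) = v := hwv
      rw [← this]
      change _ = _ - s • (w' : H) + s • (w' : H)
      rw [sub_add_cancel]
    have hq : ∀ z : D, E w' z = inner ℝ (v : H) (z : H) + s * inner ℝ (w' : H) (z : H) := by
      intro z
      rw [hwE z, hT, inner_add_left, inner_smul_left]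
      rfl
    have h1 := hs (v + (-(‖R‖ + 1)⁻¹) • w')
    rw [form_add_smul_self hsymm, hsymm v w', hq v, hq w',
      Submodule.coe_add, Submodule.coe_smul, norm_add_smul_sq, real_inner_self_eq_norm_sq,
      real_inner_self_eq_norm_sq, real_inner_comm (w' : H) (v : H)] at h1
    have h2 : inner ℝ (v : H) (w' : H) ≤ (‖R‖ + 1) * ‖(v : H)‖ ^ 2 := by
      refine (real_inner_le_norm _ _).trans ?_
      rw [hw']
      have := R.le_opNorm v
      nlinarith [norm_nonneg (v : H)]
    rw [real_inner_comm (w' : H) (v : H)] at h2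
    have h3 : (‖R‖ + 1)⁻¹ ^ 2 * inner ℝ (w' : H) (v : H) ≤ (‖R‖ + 1)⁻¹ * ‖(v : H)‖ ^ 2 := by
      calc _ ≤ (‖R‖ + 1)⁻¹ ^ 2 * ((‖R‖ + 1) * ‖(v : H)‖ ^ 2) := by gcongr
        _ = _ := by field_simp
    have h4 : (‖R‖ + 1)⁻¹ ^ 2 * inner ℝ (w' : H) (v : H) =
        (‖R‖ + 1)⁻¹ * ((‖R‖ + 1)⁻¹ * inner ℝ (w' : H) (v : H)) := by ring
    linarith
  have := le_csSup ⟨c, hup⟩ hmem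
  have : 0 < (‖R‖ + 1)⁻¹ := by positivity
  linarith

/-- A sequence converges weakly to zero. -/
def WeaklyNull (u : ℕ → H) : Prop := ∀ h : H, Tendsto (fun k => inner ℝ h (u k)) atTop (𝓝 0)

theorem WeaklyNull.map [CompleteSpace H] {u : ℕ → H} (hu : WeaklyNull u) (B : H →L[ℝ] H) :
    WeaklyNull fun k => B (u k) := fun h => by
  simpa only [ContinuousLinearMap.adjoint_inner_left] using hu (B.adjoint h)

theorem WeaklyNull.add_smul {u v : ℕ → H} (hu : WeaklyNull u) (hv : WeaklyNull v) (t : ℝ) :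
    WeaklyNull fun k => u k + t • v k := fun h => by
  simpa [inner_add_right, inner_smul_right] using (hu h).add ((hv h).const_mul t)

theorem WeaklyNull.tendsto_starProjection {u : ℕ → H} (hu : WeaklyNull u) (V : Submodule ℝ H)
    [FiniteDimensional ℝ V] : Tendsto (fun k => ‖V.starProjection (u k)‖ ^ 2) atTop (𝓝 0) := by
  have h (k) : V.starProjection (u k) =
      ∑ i, inner ℝ (stdOrthonormalBasis ℝ V i : H) (u k) • (stdOrthonormalBasis ℝ V i : H) := by
    rw [Submodule.starProjection_apply,
      (stdOrthonormalBasis ℝ V).orthogonalProjectionOnto_apply_eq_sum]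
    simp
  have h1 : Tendsto (fun k => V.starProjection (u k)) atTop (𝓝 0) := by
    simp_rw [h]
    rw [← Finset.sum_const_zero (s := (Finset.univ : Finset (Fin (Module.finrank ℝ V))))]
    exact tendsto_finsetSum _ fun i _ => by
      simpa using (hu (stdOrthonormalBasis ℝ V i : H)).smul_const (stdOrthonormalBasis ℝ V i : H)
  simpa using (h1.norm.pow 2)

theorem Submodule.finiteDimensional_orthogonal_of_quotient [CompleteSpace H] (V : Submodule ℝ H)
    (hV : IsClosed (V : Set H)) [FiniteDimensional ℝ (H ⧸ V)] : FiniteDimensional ℝ Vᗮ := by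
  have : CompleteSpace V := hV.completeSpace_coe
  exact ((V.quotientEquivOfIsCompl Vᗮ V.isCompl_orthogonal).finiteDimensional)

/-- If the operator of a form with closed graph is Fredholm after a shift by `s`, then it has a
bounded right inverse on its range. -/
theorem exists_boundedRightInverse [CompleteSpace H] {D : Submodule ℝ H} (hD : Dense (D : Set H))
    {E : D →ₗ[ℝ] D →ₗ[ℝ] ℝ} (hclosed : IsClosed (formGraph D E : Set (H × H))) {s : ℝ}
    (hs : s ∉ opEssSpectrum (formOperator D E)) :
    ∃ (V : Submodule ℝ H) (_ : FiniteDimensional ℝ V) (B : H →L[ℝ] H),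
      ∀ v : H, (B v, v - V.starProjection v + s • B v) ∈ formGraph D E := by
  simp only [opEssSpectrum, Set.mem_ofPred_eq, not_not] at hs
  obtain ⟨hker, hcl, hfin⟩ := hs
  set T := formOperator D E
  set R := LinearMap.range (shiftedOp T s) with hR
  have : CompleteSpace R := hcl.completeSpace_coe
  have hV := R.finiteDimensional_orthogonal_of_quotient hcl
  have hgr : T.graph = formGraph D E := formOperator_graph hD E
  have : CompleteSpace (formGraph D E) := hclosed.completeSpace_coe
  -- On the graph, a Banach space because it is closed, `T - s` becomes a bounded operator.
  let Φ₀ : formGraph D E →L[ℝ] H :=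
    (ContinuousLinearMap.snd ℝ H H - s • ContinuousLinearMap.fst ℝ H H) ∘L
      (formGraph D E).subtypeL
  have hΦ₀ (p : formGraph D E) : ∃ u : T.domain, (u : H) = p.1.1 ∧ shiftedOp T s u = Φ₀ p := by
    have hp : p.1 ∈ T.graph := by
      rw [hgr]
      exact p.2
    obtain ⟨u, hu, hu'⟩ := (LinearPMap.mem_graph_iff _).1 hp
    refine ⟨u, hu, ?_⟩
    change T u - s • (u : H) = p.1.2 - s • p.1.1
    rw [hu, hu']
  let Φ : formGraph D E →L[ℝ] R := Φ₀.codRestrict R fun p => by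
    obtain ⟨u, -, hu⟩ := hΦ₀ p
    exact ⟨u, hu⟩
  have hsurj : Φ.range = ⊤ := by
    refine LinearMap.range_eq_top.2 ?_
    rintro ⟨_, u, rfl⟩
    refine ⟨⟨(u, T u), hgr ▸ T.mem_graph u⟩, Subtype.ext rfl⟩
  -- The first coordinate embeds this kernel into that of `T - s`.
  have : FiniteDimensional ℝ Φ.ker := by
    let g : Φ.ker →ₗ[ℝ] H :=
      LinearMap.fst ℝ H H ∘ₗ (formGraph D E).subtype ∘ₗ Φ.ker.subtype
    have hg : Function.Injective g := by
      rintro ⟨⟨⟨a, b⟩, h1⟩, h2⟩ ⟨⟨⟨a', b'⟩, h1'⟩, h2'⟩ h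
      have ha : a = a' := h
      subst ha
      have : b = b' := T.mem_graph_snd_inj (hgr ▸ h1) (hgr ▸ h1') rfl
      subst this
      rfl
    have : FiniteDimensional ℝ ((LinearMap.ker (shiftedOp T s)).map T.domain.subtype) :=
      inferInstance
    refine FiniteDimensional.of_injective
      (g.codRestrict ((LinearMap.ker (shiftedOp T s)).map T.domain.subtype) ?_) ?_
    · intro p
      obtain ⟨u, hu, hu'⟩ := hΦ₀ p.1
      refine ⟨u, ?_, hu⟩
      have : Φ p.1 = 0 := p.2
      change shiftedOp T s u = 0
      rw [hu']
      exact congrArg Subtype.val this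
    · exact fun p q h => hg (congrArg Subtype.val h)
  -- A finite-dimensional kernel has a closed complement, on which `Φ` is a continuous isomorphism
  -- onto the range; its inverse `J` is a bounded right inverse of `Φ`.
  obtain ⟨π, hπ⟩ := Submodule.ClosedComplemented.of_finiteDimensional (𝕜 := ℝ) Φ.ker
  have hπs : π.range = ⊤ := LinearMap.range_eq_top.2 fun x => ⟨x, hπ x⟩
  have hc : IsCompl Φ.ker π.ker := LinearMap.isCompl_of_proj hπ
  let e := ContinuousLinearMap.equivProdOfSurjectiveOfIsCompl (𝕜 := ℝ) (G := Φ.ker) Φ π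
    hsurj hπs hc
  let J : R →L[ℝ] formGraph D E := (e.symm : R × Φ.ker →L[ℝ] formGraph D E) ∘L
    ContinuousLinearMap.inl ℝ R Φ.ker
  have hJ (r : R) : Φ (J r) = r := by
    have := e.apply_symm_apply (r, 0)
    exact congrArg Prod.fst this
  -- `B` projects onto the range before inverting, so `(T - s) B v` misses `v` exactly by its
  -- component in the finite-dimensional space `Rᗮ`.
  refine ⟨Rᗮ, hV, ContinuousLinearMap.fst ℝ H H ∘L (formGraph D E).subtypeL ∘L J ∘L
    R.orthogonalProjectionOnto, fun v => ?_⟩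
  have h1 := congrArg Subtype.val (hJ (R.orthogonalProjectionOnto v))
  have h2 : v - Rᗮ.starProjection v = R.orthogonalProjectionOnto v := by
    rw [sub_eq_iff_eq_add]
    exact (R.starProjection_add_starProjection_orthogonal v).symm
  rw [h2, ← h1]
  set p := J (R.orthogonalProjectionOnto v)
  have h3 : (((Φ p : R) : H) + s • p.1.1) = p.1.2 := by
    change p.1.2 - s • p.1.1 + s • p.1.1 = _
    rw [sub_add_cancel]
  change (p.1.1, ((Φ p : R) : H) + s • p.1.1) ∈ _
  rw [h3]
  exact p.2

/-- The bottom of the essential spectrum is at most the asymptotic Rayleigh quotient of a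
normalized weakly null sequence. -/
theorem exists_mem_opEssSpectrum_le [CompleteSpace H] {D : Submodule ℝ H}
    (hD : Dense (D : Set H)) {E : D →ₗ[ℝ] D →ₗ[ℝ] ℝ} (hsymm : ∀ u v, E u v = E v u)
    (hnonneg : ∀ u, 0 ≤ E u u) (hclosed : IsClosed (formGraph D E : Set (H × H)))
    {c : ℝ} {u : ℕ → D} (hu : ∀ k, ‖(u k : H)‖ = 1) (hw : WeaklyNull fun k => (u k : H))
    (huc : ∀ k, E (u k) (u k) ≤ c) :
    ∃ s ∈ opEssSpectrum (formOperator D E), s ≤ c := by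
  -- The asymptotic counterpart of a lower form bound: it is tested only on bounded weakly null
  -- sequences, up to an arbitrary error `ε`.
  set S : Set ℝ := {t | ∀ (C : ℝ) (v : ℕ → D), (∀ k, ‖(v k : H)‖ ≤ C) →
    (WeaklyNull fun k => (v k : H)) → ∀ ε > 0, ∀ᶠ k in atTop,
      t * ‖(v k : H)‖ ^ 2 ≤ E (v k) (v k) + ε} with hS
  have hS0 : (0 : ℝ) ∈ S := fun C v _ _ ε hε => Eventually.of_forall fun k => by
    have := hnonneg (v k)
    linarith
  have hup : c ∈ upperBounds S := by
    intro t ht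
    refine le_of_forall_pos_le_add fun ε hε => ?_
    obtain ⟨k, hk⟩ := (ht 1 u (fun k => (hu k).le) hw ε hε).exists
    rw [hu k] at hk
    linarith [huc k]
  have hs : sSup S ∈ S := by
    intro C v hv hvw ε hε
    have hd : 0 < ε / 2 / (C ^ 2 + 1) := by positivity
    obtain ⟨t, ht, hts⟩ := exists_lt_of_lt_csSup ⟨0, hS0⟩ (sub_lt_self (sSup S) hd)
    filter_upwards [ht C v hv hvw (ε / 2) (by positivity)] with k hk
    have h1 : ‖(v k : H)‖ ^ 2 ≤ C ^ 2 + 1 := by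
      have := pow_le_pow_left₀ (norm_nonneg _) (hv k) 2
      linarith
    have h2 : sSup S - t ≤ ε / 2 / (C ^ 2 + 1) := by linarith
    have h3 : (sSup S - t) * ‖(v k : H)‖ ^ 2 ≤ ε / 2 / (C ^ 2 + 1) * (C ^ 2 + 1) := by
      gcongr
    rw [div_mul_cancel₀ _ (by positivity)] at h3
    linarith
  set s := sSup S
  refine ⟨s, ?_, csSup_le ⟨0, hS0⟩ hup⟩
  by_contra hess
  obtain ⟨V, hV, B, hB⟩ := exists_boundedRightInverse hD hclosed hess
  have hM : 0 < ‖B‖ + 1 := by positivity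
  -- The same perturbation `v - τ B v` as for the spectrum. It is again bounded and weakly null, and
  -- the defect in `V` tends to zero in norm because `V` is finite dimensional.
  have hmem : s + (‖B‖ + 1)⁻¹ ∈ S := by
    intro C v hv hvw ε hε
    set P : H → H := fun z => z - V.starProjection z
    set τ := (‖B‖ + 1)⁻¹ with hτ
    have hτ0 : 0 < τ := by positivity
    choose w hw hwE using fun k => hB (v k)
    have hwE' : ∀ k, ∀ z : D, E (w k) z =
        inner ℝ (P (v k)) (z : H) + s * inner ℝ (w k : H) (z : H) := by
      intro k z
      rw [hwE k z]
      change inner ℝ (P (v k) + s • B (v k)) (z : H) = _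
      rw [inner_add_left, inner_smul_left, hw k]
      rfl
    have hwB : ∀ k, (w k : H) = B (v k) := hw
    have hww : WeaklyNull fun k => (w k : H) := by
      simp_rw [hwB]
      exact hvw.map B
    have hC : 0 ≤ C := (norm_nonneg _).trans (hv 0)
    have hbd : ∀ k, ‖((v k + (-τ) • w k : D) : H)‖ ≤ C + τ * (‖B‖ * C) := by
      intro k
      rw [Submodule.coe_add, Submodule.coe_smul]
      refine (norm_add_le _ _).trans (add_le_add (hv k) ?_)
      rw [norm_smul, norm_neg, Real.norm_of_nonneg hτ0.le, hwB]
      gcongr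
      exact (B.le_opNorm _).trans (by gcongr; exact hv k)
    have hproj := hvw.tendsto_starProjection V
    have hcross := hs _ _ hbd (by simpa using hvw.add_smul hww (-τ)) (ε / 2) (by positivity)
    -- The defect enters as `2τ ‖P_V v‖²`, where `P_V` projects onto `V`; the threshold `ε / (4τ)`
    -- makes this at most `ε / 2`.
    filter_upwards [hcross, hproj.eventually_lt_const (show 0 < ε / (4 * τ) by positivity)]
      with k hk hk'
    rw [form_add_smul_self hsymm, hsymm (v k) (w k), hwE', hwE', Submodule.coe_add,
      Submodule.coe_smul, norm_add_smul_sq, real_inner_self_eq_norm_sq,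
      real_inner_comm (w k : H) (v k : H)] at hk
    have h1 : inner ℝ (P (v k)) (v k : H) =
        ‖(v k : H)‖ ^ 2 - ‖V.starProjection (v k : H)‖ ^ 2 := by
      have h0 := V.starProjection_inner_eq_zero (v k : H) _ (V.starProjection_apply_mem (v k : H))
      rw [inner_sub_left, real_inner_self_eq_norm_sq] at h0 ⊢
      rw [real_inner_comm (v k : H)]
      linarith
    have h2 : inner ℝ (P (v k)) (w k : H) ≤ (‖B‖ + 1) * ‖(v k : H)‖ ^ 2 := by
      have hP : ‖P (v k)‖ ≤ ‖(v k : H)‖ := by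
        have : P (v k) = Vᗮ.starProjection (v k : H) := by
          rw [sub_eq_iff_eq_add']
          exact (V.starProjection_add_starProjection_orthogonal _).symm
        rw [this]
        exact Submodule.norm_starProjection_apply_le _ _
      have hwk : ‖(w k : H)‖ ≤ ‖B‖ * ‖(v k : H)‖ := hwB k ▸ B.le_opNorm _
      calc _ ≤ ‖P (v k)‖ * ‖(w k : H)‖ := real_inner_le_norm _ _
        _ ≤ ‖(v k : H)‖ * (‖B‖ * ‖(v k : H)‖) := by gcongr
        _ ≤ _ := by nlinarith [sq_nonneg ‖(v k : H)‖]
    have h3 : τ ^ 2 * inner ℝ (P (v k)) (w k : H) ≤ τ * ‖(v k : H)‖ ^ 2 := by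
      calc _ ≤ τ ^ 2 * ((‖B‖ + 1) * ‖(v k : H)‖ ^ 2) := by gcongr
        _ = _ := by rw [hτ]; field_simp
    have h4 : 2 * τ * ‖V.starProjection (v k : H)‖ ^ 2 ≤ ε / 2 := by
      calc _ ≤ 2 * τ * (ε / (4 * τ)) := by gcongr
        _ = _ := by field_simp; ring
    rw [h1] at hk
    linarith
  have := le_csSup ⟨c, hup⟩ hmem
  have : 0 < (‖B‖ + 1)⁻¹ := by positivity
  linarith

end HilbertSpace

theorem specBottom_le {H : Type*} [NormedAddCommGroup H] [InnerProductSpace ℝ H] (T : H →ₗ.[ℝ] H)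
    {s : ℝ} (hs : s ∈ opSpectrum T) : specBottom T ≤ s :=
  sInf_le (Set.mem_image_of_mem _ hs)

theorem essSpecBottom_le {H : Type*} [NormedAddCommGroup H] [InnerProductSpace ℝ H]
    (T : H →ₗ.[ℝ] H) {s : ℝ} (hs : s ∈ opEssSpectrum T) : essSpecBottom T ≤ s :=
  sInf_le (Set.mem_image_of_mem _ hs)

/-! ### Closedness of the maximal form and transfer to test functions. -/

namespace WeightedGraph

variable {X : Type*} [MeasurableSpace X] (G : WeightedGraph X)

theorem coe_sub (u v : G.L2) : ((u - v : G.L2) : X → ℝ) = u - v := G.eq_of_ae (Lp.coeFn_sub u v)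

theorem energy_eq_ofReal {u : X → ℝ} (hu : G.energy u < ∞) : G.energy u =
    ENNReal.ofReal (2⁻¹ * ∑' p : X × X, (G.b p.1 p.2 : ℝ) * (u p.1 - u p.2) ^ 2) := by
  rw [ENNReal.ofReal_mul (by norm_num), ENNReal.ofReal_tsum_of_nonneg (fun p => by positivity)
    ((G.energy_lt_top_iff u).1 hu), ENNReal.ofReal_inv_of_pos (by norm_num), energy]
  simp [ENNReal.ofReal_mul]

/-- Allows form estimates to be proved for the `[0,∞]`-valued energy, where no summability has to be
checked. -/
theorem ofReal_maxForm_self (u : G.maxDomain) :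
    ENNReal.ofReal (G.maxForm u u) = G.energy (u : G.L2) := by
  rw [G.energy_eq_ofReal u.2]
  change ENNReal.ofReal ((2⁻¹ : ℝ) * _) = _
  simp_rw [pow_two, mul_assoc]

theorem maxForm_symm (u v : G.maxDomain) : G.maxForm u v = G.maxForm v u := by
  change (2⁻¹ : ℝ) * _ = (2⁻¹ : ℝ) * _
  congr 1
  exact tsum_congr fun p => by ring

theorem maxForm_self_nonneg (u : G.maxDomain) : 0 ≤ G.maxForm u u := by
  change (0 : ℝ) ≤ 2⁻¹ * _
  refine mul_nonneg (by norm_num) (tsum_nonneg fun p => ?_)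
  rw [mul_assoc]
  exact mul_nonneg (NNReal.coe_nonneg _) (mul_self_nonneg _)

theorem maxForm_sq_le (u v : G.maxDomain) :
    G.maxForm u v ^ 2 ≤ G.maxForm u u * G.maxForm v v :=
  LinearMap.BilinForm.apply_sq_le_of_symm G.maxForm G.maxForm_self_nonneg
    ⟨fun a b => G.maxForm_symm a b⟩ u v

/-- The energy is lower semicontinuous with respect to pointwise convergence. -/
theorem energy_le_of_tendsto {f : ℕ → X → ℝ} {g : X → ℝ}
    (h : ∀ x, Tendsto (fun k => f k x) atTop (𝓝 (g x))) {C : ℝ≥0∞}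
    (hC : ∀ᶠ k in atTop, G.energy (f k) ≤ C) : G.energy g ≤ C := by
  simp only [energy, ← ENNReal.tsum_mul_left] at hC ⊢
  rw [ENNReal.tsum_eq_iSup_sum]
  refine iSup_le fun s => ?_
  -- Fatou's lemma by hand: finite partial sums pass to the limit and are bounded by the full
  -- energies.
  refine le_of_tendsto (f := fun k => ∑ p ∈ s, 2⁻¹ * ((G.b p.1 p.2 : ℝ≥0∞) *
    ENNReal.ofReal ((f k p.1 - f k p.2) ^ 2))) (x := atTop) (tendsto_finsetSum _ fun p _ => ?_) ?_
  · refine ENNReal.Tendsto.const_mul (ENNReal.Tendsto.const_mul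
      (ENNReal.tendsto_ofReal (((h p.1).sub (h p.2)).pow 2)) (Or.inr (by simp))) (Or.inr (by simp))
  · filter_upwards [hC] with k hk
    exact (ENNReal.sum_le_tsum s).trans hk

/-- The square of the norm in `ℓ²(X, m)` of a function, with values in `[0, ∞]`. -/
def sqNorm (f : X → ℝ) : ℝ≥0∞ := ∫⁻ x, ENNReal.ofReal (f x ^ 2) ∂G.m

theorem sqNorm_coe (u : G.L2) : G.sqNorm u = ENNReal.ofReal (‖u‖ ^ 2) := by
  rw [← real_inner_self_eq_norm_sq, L2.inner_def,
    ofReal_integral_eq_lintegral_ofReal (L2.integrable_inner u u)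
      (Eventually.of_forall fun x => real_inner_self_nonneg), sqNorm]
  simp [pow_two]

theorem measure_singleton_toReal_pos (x : X) : 0 < (G.m {x}).toReal :=
  ENNReal.toReal_pos (G.m_pos x).ne' (G.m_lt_top x).ne

variable [DiscreteMeasurableSpace X]

theorem inner_single (x : X) (u : G.L2) :
    inner ℝ (G.single x) u = (G.m {x}).toReal * (u : X → ℝ) x := by
  rw [single, L2.inner_indicatorConstLp_one, Measure.restrict_singleton,
    integral_smul_measure, integral_dirac, smul_eq_mul]

theorem tendsto_coe_apply {u : ℕ → G.L2} {v : G.L2} (h : Tendsto u atTop (𝓝 v)) (x : X) :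
    Tendsto (fun k => (u k : X → ℝ) x) atTop (𝓝 ((v : X → ℝ) x)) := by
  have h1 : Tendsto (fun k => inner ℝ (G.single x) (u k)) atTop (𝓝 (inner ℝ (G.single x) v)) :=
    tendsto_const_nhds.inner h
  simp_rw [inner_single] at h1
  have h2 := h1.const_mul (G.m {x}).toReal⁻¹
  simpa [inv_mul_cancel_left₀ (G.measure_singleton_toReal_pos x).ne'] using h2

/-- For graph elements `(uₙ, wₙ)` one has `E(uₙ - uₖ) = ⟪wₙ - wₖ, uₙ - uₖ⟫`, so graph convergence
makes `uₙ` Cauchy in energy. Lower semicontinuity upgrades this to `E(u - uₙ) → 0`, and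
Cauchy–Schwarz passes `E(uₙ, v) = ⟪wₙ, v⟫` to the limit. -/
theorem isClosed_formGraph_maxForm :
    IsClosed (formGraph G.maxDomain G.maxForm : Set (G.L2 × G.L2)) := by
  refine IsSeqClosed.isClosed fun p q hp hpq => ?_
  choose U hU hE using hp
  have h1 : Tendsto (fun k => (p k).1) atTop (𝓝 q.1) := (continuous_fst.tendsto q).comp hpq
  have h2 : Tendsto (fun k => (p k).2) atTop (𝓝 q.2) := (continuous_snd.tendsto q).comp hpq
  have hcauchy : ∀ ε > 0, ∃ N, ∀ n ≥ N, ∀ k ≥ N, G.maxForm (U k - U n) (U k - U n) ≤ ε := by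
    intro ε hε
    have hd1 : Tendsto (fun n : ℕ × ℕ => (p n.1).1 - (p n.2).1) (atTop ×ˢ atTop) (𝓝 (q.1 - q.1)) :=
      (h1.comp tendsto_fst).sub (h1.comp tendsto_snd)
    have hd2 : Tendsto (fun n : ℕ × ℕ => (p n.1).2 - (p n.2).2) (atTop ×ˢ atTop) (𝓝 (q.2 - q.2)) :=
      (h2.comp tendsto_fst).sub (h2.comp tendsto_snd)
    have hd := hd2.inner (𝕜 := ℝ) hd1
    rw [sub_self, inner_zero_left, prod_atTop_atTop_eq] at hd
    obtain ⟨N, hN⟩ := eventually_atTop_prod_self.1 (hd.eventually_lt_const hε)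
    refine ⟨N, fun n hn k hk => ?_⟩
    have := (hN k n hk hn).le
    rw [(G.maxForm).map_sub, LinearMap.sub_apply, hE, hE, ← inner_sub_left, Submodule.coe_sub, hU, hU]
    exact this
  have hlim : ∀ ε > 0, ∃ N, ∀ n ≥ N,
      G.energy ((q.1 - U n : G.L2) : X → ℝ) ≤ ENNReal.ofReal ε := by
    intro ε hε
    obtain ⟨N, hN⟩ := hcauchy ε hε
    refine ⟨N, fun n hn => G.energy_le_of_tendsto (f := fun k => ((U k - U n : G.L2) : X → ℝ))
      (fun x => G.tendsto_coe_apply ?_ x) ?_⟩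
    · simp_rw [hU]
      exact h1.sub_const _
    · filter_upwards [eventually_ge_atTop N] with k hk
      rw [← Submodule.coe_sub, ← ofReal_maxForm_self]
      exact ENNReal.ofReal_le_ofReal (hN n hn k hk)
  have hqD : q.1 ∈ G.maxDomain := by
    obtain ⟨N, hN⟩ := hlim 1 one_pos
    have : q.1 - U N ∈ G.maxDomain := (hN N le_rfl).trans_lt ENNReal.ofReal_lt_top
    simpa using add_mem this (U N).2
  refine ⟨⟨q.1, hqD⟩, rfl, fun v => ?_⟩
  set u : G.maxDomain := ⟨q.1, hqD⟩
  have hE0 : Tendsto (fun n => G.maxForm (u - U n) (u - U n)) atTop (𝓝 0) := by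
    rw [Metric.tendsto_atTop]
    intro ε hε
    obtain ⟨N, hN⟩ := hlim (ε / 2) (by positivity)
    refine ⟨N, fun n hn => ?_⟩
    have h3 := hN n hn
    have h4 : G.energy ((q.1 - U n : G.L2) : X → ℝ) = _ := (G.ofReal_maxForm_self (u - U n)).symm
    rw [h4, ENNReal.ofReal_le_ofReal_iff (by positivity)] at h3
    rw [Real.dist_eq, sub_zero, abs_of_nonneg (G.maxForm_self_nonneg _)]
    linarith
  have hsq : Tendsto (fun n => G.maxForm (u - U n) v ^ 2) atTop (𝓝 0) :=
    squeeze_zero (fun n => sq_nonneg _) (fun n => G.maxForm_sq_le _ _)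
      (by simpa using hE0.mul_const (G.maxForm v v))
  have hEv : Tendsto (fun n => G.maxForm (u - U n) v) atTop (𝓝 0) := by
    have := hsq.sqrt
    simp_rw [Real.sqrt_sq_eq_abs, Real.sqrt_zero] at this
    exact (tendsto_zero_iff_abs_tendsto_zero _).2 this
  have hEv' : Tendsto (fun n => G.maxForm u v - inner ℝ (p n).2 (v : G.L2)) atTop
      (𝓝 (G.maxForm u v - inner ℝ q.2 (v : G.L2))) :=
    (h2.inner tendsto_const_nhds).const_sub _
  have : G.maxForm u v - inner ℝ q.2 (v : G.L2) = 0 := by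
    refine tendsto_nhds_unique hEv' (hEv.congr fun n => ?_)
    rw [map_sub, LinearMap.sub_apply, hE]
  linarith

/-- The vectors whose inner products with `u k` tend to zero form a subspace containing every
`single x`, hence dense; boundedness extends the convergence to all vectors. -/
theorem weaklyNull_of_tendsto [Countable X] {u : ℕ → G.L2} {C : ℝ} (hC : ∀ k, ‖u k‖ ≤ C)
    (h : ∀ x, Tendsto (fun k => (u k : X → ℝ) x) atTop (𝓝 0)) : WeaklyNull u := by
  have hC0 : 0 ≤ C := (norm_nonneg _).trans (hC 0)
  let V : Submodule ℝ G.L2 :=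
    { carrier := {v | Tendsto (fun k => inner ℝ v (u k)) atTop (𝓝 0)}
      zero_mem' := by simp
      add_mem' := fun {a b} ha hb => by
        have := Tendsto.add ha hb
        simpa [inner_add_left] using this
      smul_mem' := fun c a ha => by
        have := Tendsto.const_mul c ha
        simpa [inner_smul_left] using this }
  have hV : Dense (V : Set G.L2) := by
    rw [Submodule.dense_iff_topologicalClosure_eq_top, Submodule.topologicalClosure_eq_top_iff,
      Submodule.eq_bot_iff]
    intro v hv
    have h0 : (v : X → ℝ) = 0 := by
      funext x
      have hx : G.single x ∈ V := by
        change Tendsto _ _ _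
        simp_rw [inner_single]
        simpa using (h x).const_mul (G.m {x}).toReal
      have := (Submodule.mem_orthogonal _ _).1 hv _ hx
      rw [inner_single] at this
      exact (mul_eq_zero.1 this).resolve_left (G.measure_singleton_toReal_pos x).ne'
    apply Lp.ext
    rw [h0, coe_zero]
  intro v
  rw [Metric.tendsto_atTop]
  intro ε hε
  obtain ⟨w, hw, hvw⟩ := Metric.dense_iff.1 hV v (ε / 2 / (C + 1)) (by positivity)
  obtain ⟨N, hN⟩ := Metric.tendsto_atTop.1 (show Tendsto _ _ _ from hvw) (ε / 2) (by positivity)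
  refine ⟨N, fun n hn => ?_⟩
  have h1 := hN n hn
  rw [Real.dist_eq, sub_zero] at h1 ⊢
  have h2 : |inner ℝ (v - w) (u n)| ≤ ε / 2 / (C + 1) * (C + 1) := by
    refine (abs_real_inner_le_norm _ _).trans ?_
    have h3 : ‖v - w‖ ≤ ε / 2 / (C + 1) := by
      rw [← dist_eq_norm, dist_comm]
      exact (Metric.mem_ball.1 hw).le
    gcongr
    linarith [hC n]
  rw [div_mul_cancel₀ _ (by positivity), inner_sub_left] at h2
  have := abs_add_le (inner ℝ v (u n) - inner ℝ w (u n)) (inner ℝ w (u n))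
  rw [sub_add_cancel] at this
  linarith

/-- A function of finite nonzero norm and finite energy, normalized, as an element of the form
domain. -/
theorem exists_normalized {f : X → ℝ} (h0 : G.sqNorm f ≠ 0) (htop : G.sqNorm f ≠ ∞) {c : ℝ}
    (hc : 0 ≤ c) (hf : G.energy f ≤ ENNReal.ofReal c * G.sqNorm f) :
    ∃ u : G.maxDomain, ‖(u : G.L2)‖ = 1 ∧ G.maxForm u u ≤ c ∧
      ∀ x, ((u : G.L2) : X → ℝ) x = (√(G.sqNorm f).toReal)⁻¹ * f x := by
  have hmem : MemLp f 2 G.m := by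
    refine ⟨Measurable.of_discrete.aestronglyMeasurable, ?_⟩
    rw [eLpNorm_lt_top_iff_lintegral_rpow_enorm_lt_top (by norm_num) (by norm_num)]
    refine lt_of_eq_of_lt ?_ (lt_top_iff_ne_top.2 htop)
    refine lintegral_congr fun x => ?_
    rw [Real.enorm_eq_ofReal_abs, ENNReal.toReal_ofNat, ENNReal.rpow_ofNat,
      ← ENNReal.ofReal_pow (abs_nonneg _), sq_abs]
  have hcoe : (hmem.toLp f : X → ℝ) = f := G.eq_of_ae hmem.coeFn_toLp
  set F := hmem.toLp f
  have hFD : F ∈ G.maxDomain := by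
    change G.energy F < ∞
    rw [hcoe]
    exact hf.trans_lt (ENNReal.mul_lt_top ENNReal.ofReal_lt_top (lt_top_iff_ne_top.2 htop))
  set F' : G.maxDomain := ⟨F, hFD⟩
  have hN : (G.sqNorm f).toReal = ‖F‖ ^ 2 := by
    rw [← hcoe, sqNorm_coe, ENNReal.toReal_ofReal (by positivity)]
  have hNpos : 0 < (G.sqNorm f).toReal := ENNReal.toReal_pos h0 htop
  have hs : √(G.sqNorm f).toReal = ‖F‖ := by rw [hN, Real.sqrt_sq (norm_nonneg _)]
  have hFpos : 0 < ‖F‖ := by rw [← hs]; exact Real.sqrt_pos.2 hNpos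
  refine ⟨(√(G.sqNorm f).toReal)⁻¹ • F', ?_, ?_, fun x => ?_⟩
  · rw [Submodule.coe_smul, norm_smul, hs, norm_inv, norm_norm]
    exact inv_mul_cancel₀ hFpos.ne'
  · have h1 : G.maxForm F' F' ≤ c * ‖F‖ ^ 2 := by
      rw [← ENNReal.ofReal_le_ofReal_iff (by positivity), ofReal_maxForm_self, ENNReal.ofReal_mul hc,
        ← sqNorm_coe]
      change G.energy F ≤ _ * G.sqNorm F
      rw [hcoe]
      exact hf
    rw [(G.maxForm).map_smul, LinearMap.smul_apply, map_smul, hs, smul_eq_mul, smul_eq_mul]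
    calc _ ≤ ‖F‖⁻¹ * (‖F‖⁻¹ * (c * ‖F‖ ^ 2)) := by gcongr
      _ = c := by field_simp
  · rw [Submodule.coe_smul, coe_smul, Pi.smul_apply, smul_eq_mul]
    change _ * (F : X → ℝ) x = _
    rw [hcoe]

theorem specBottom_Lmax_le [Countable X] {f : X → ℝ} (h0 : G.sqNorm f ≠ 0)
    (htop : G.sqNorm f ≠ ∞) {c : ℝ} (hc : 0 ≤ c)
    (hf : G.energy f ≤ ENNReal.ofReal c * G.sqNorm f) : specBottom G.Lmax ≤ (c : EReal) := by
  obtain ⟨u, hu, huc, -⟩ := G.exists_normalized h0 htop hc hf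
  obtain ⟨s, hs, hsc⟩ := exists_mem_opSpectrum_le G.dense_maxDomain G.maxForm_symm
    G.maxForm_self_nonneg (c := c) (u := u) (fun h => by simp [h] at hu) (by simpa [hu] using huc)
  exact (specBottom_le G.Lmax hs).trans (EReal.coe_le_coe_iff.2 hsc)

theorem essSpecBottom_Lmax_le [Countable X] {f : ℕ → X → ℝ} (h0 : ∀ k, G.sqNorm (f k) ≠ 0)
    (htop : ∀ k, G.sqNorm (f k) ≠ ∞) {c : ℝ} (hc : 0 ≤ c)
    (hf : ∀ k, G.energy (f k) ≤ ENNReal.ofReal c * G.sqNorm (f k))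
    (hnull : ∀ x, Tendsto (fun k => (√(G.sqNorm (f k)).toReal)⁻¹ * f k x) atTop (𝓝 0)) :
    essSpecBottom G.Lmax ≤ (c : EReal) := by
  choose u hu huc hux using fun k => G.exists_normalized (h0 k) (htop k) hc (hf k)
  have hw : WeaklyNull fun k => (u k : G.L2) :=
    G.weaklyNull_of_tendsto (fun k => (hu k).le) fun x => by simpa only [hux] using hnull x
  obtain ⟨s, hs, hsc⟩ := exists_mem_opEssSpectrum_le G.dense_maxDomain G.maxForm_symm
    G.maxForm_self_nonneg G.isClosed_formGraph_maxForm hu hw huc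
  exact (essSpecBottom_le G.Lmax hs).trans (EReal.coe_le_coe_iff.2 hsc)

end WeightedGraph

/-! ### Elementary inequalities for exponentials along an edge. -/

/-- The quotient `(A - B)² / (A² + B²)` depends only on the ratio of `A` and `B` and is worst at the
extreme ratio `e^d`. -/
theorem exp_neg_sub_sq_le {a b d θ : ℝ} (hab : |a - b| ≤ d)
    (hθ : (Real.exp d - 1) ^ 2 ≤ θ * (Real.exp (2 * d) + 1)) :
    (Real.exp (-a) - Real.exp (-b)) ^ 2 ≤ θ * (Real.exp (-a) ^ 2 + Real.exp (-b) ^ 2) := by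
  obtain ⟨h1, h2⟩ := abs_le.1 hab
  have hA : Real.exp (-a) ≤ Real.exp d * Real.exp (-b) := by
    rw [← Real.exp_add]
    exact Real.exp_le_exp.2 (by linarith)
  have hB : Real.exp (-b) ≤ Real.exp d * Real.exp (-a) := by
    rw [← Real.exp_add]
    exact Real.exp_le_exp.2 (by linarith)
  have hE : Real.exp (2 * d) = Real.exp d ^ 2 := by
    rw [← Real.exp_nat_mul]
    norm_num
  rw [hE] at hθ
  set A := Real.exp (-a)
  set B := Real.exp (-b)
  set e := Real.exp d
  -- The right side minus the left side is `2 (e B - A)(e A - B)`.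
  have hAB : (A - B) ^ 2 * (e ^ 2 + 1) ≤ (e - 1) ^ 2 * (A ^ 2 + B ^ 2) := by
    nlinarith [mul_nonneg (sub_nonneg.2 hA) (sub_nonneg.2 hB)]
  have h3 : (e - 1) ^ 2 * (A ^ 2 + B ^ 2) ≤ θ * (e ^ 2 + 1) * (A ^ 2 + B ^ 2) := by gcongr
  have h4 : 0 < e ^ 2 + 1 := by positivity
  refine le_of_mul_le_mul_right (hAB.trans (h3.trans_eq ?_)) h4
  ring

/-- After division by `2 e^s` this reads `cosh s · (1 - s²/2) ≤ 1`, which follows from `cosh s ≤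
exp(s²/2)` and `1 - s²/2 ≤ exp(-s²/2)`. -/
theorem exp_sub_one_sq_le (s : ℝ) :
    (Real.exp s - 1) ^ 2 ≤ s ^ 2 / 2 * (Real.exp (2 * s) + 1) := by
  have h1 : Real.cosh s * (1 - s ^ 2 / 2) ≤ 1 := by
    calc _ ≤ Real.exp (s ^ 2 / 2) * Real.exp (-(s ^ 2 / 2)) := by
          refine (mul_le_mul_of_nonneg_left ?_ (Real.cosh_pos s).le).trans
            (mul_le_mul_of_nonneg_right (Real.cosh_le_exp_half_sq s) (Real.exp_pos _).le)
          linarith [Real.add_one_le_exp (-(s ^ 2 / 2))]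
      _ = 1 := by rw [← Real.exp_add]; simp
  have h2 : Real.exp (2 * s) = Real.exp s ^ 2 := by
    rw [← Real.exp_nat_mul]
    norm_num
  have h3 : Real.exp s * Real.exp (-s) = 1 := by rw [← Real.exp_add]; simp
  rw [Real.cosh_eq] at h1
  have h4 : Real.exp s * ((Real.exp s + Real.exp (-s)) / 2 * (1 - s ^ 2 / 2)) ≤ Real.exp s * 1 := by
    gcongr
  have h5 : Real.exp s * ((Real.exp s + Real.exp (-s)) / 2 * (1 - s ^ 2 / 2)) =
      (Real.exp s ^ 2 + Real.exp s * Real.exp (-s)) / 2 * (1 - s ^ 2 / 2) := by ring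
  rw [h5, h3] at h4
  rw [h2]
  linarith

/-- With `p = e^{αt}` and `q = e^α`, the claim is the sum of two squared inequalities: `p - 1 ≤ t (q
- 1)` by convexity, and `δ q (p - 1) ≤ t p (q - 1)` because `δ ≤ t` and `p ≤ q`. -/
theorem exp_mul_sub_one_sq_le {α t δ : ℝ} (hα : 0 ≤ α) (hδ : 0 ≤ δ) (ht : t ∈ Set.Icc δ 1) :
    (Real.exp (α * t) - 1) ^ 2 ≤ (Real.exp α - 1) ^ 2 / (δ ^ 2 * Real.exp (2 * α) + 1) * t ^ 2 *
      (Real.exp (2 * (α * t)) + 1) := by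
  obtain ⟨h1, h2⟩ := ht
  have ht0 : 0 ≤ t := hδ.trans h1
  have hE (x : ℝ) : Real.exp (2 * x) = Real.exp x ^ 2 := by
    rw [← Real.exp_nat_mul]
    norm_num
  have hconv : Real.exp (α * t) ≤ t * Real.exp α + (1 - t) := by
    have := convexOn_exp.2 (Set.mem_univ α) (Set.mem_univ 0) ht0 (sub_nonneg.2 h2)
      (add_sub_cancel t 1)
    simpa [mul_comm] using this
  have hle : Real.exp (α * t) ≤ Real.exp α := Real.exp_le_exp.2 (by nlinarith)
  have hp : 1 ≤ Real.exp (α * t) := Real.one_le_exp (by positivity)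
  rw [hE, hE]
  set p := Real.exp (α * t)
  set q := Real.exp α
  have h3 : (p - 1) ^ 2 ≤ (t * (q - 1)) ^ 2 :=
    pow_le_pow_left₀ (by linarith) (by linarith) 2
  have h4 : (δ * (q * (p - 1))) ^ 2 ≤ (t * (p * (q - 1))) ^ 2 := by
    refine pow_le_pow_left₀ (mul_nonneg hδ (mul_nonneg (by linarith) (by linarith))) ?_ 2
    exact mul_le_mul h1 (by linarith) (mul_nonneg (by linarith) (by linarith)) ht0
  rw [div_mul_eq_mul_div, div_mul_eq_mul_div, le_div_iff₀ (by positivity)]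
  linarith

/-! ### Energy estimates for an intrinsic metric and for the cut-off exponential. -/

namespace WeightedGraph

variable {X : Type*} [MeasurableSpace X] (G : WeightedGraph X)

/-- By symmetry the `P x` and `P y` terms contribute equally, and the intrinsic condition gives `∑_y
b(x,y) ρ(x,y)² ≤ 2 m(x)`; with the factor `1/2` of the energy the constant is `2K`. -/
theorem energy_le_of_sq_sub_le [Countable X] [DiscreteMeasurableSpace X] {ρ : PseudoMetric X ℝ}
    (hρ : G.IsIntrinsic ρ) {K : ℝ} (hK : 0 ≤ K) {f P : X → ℝ} (hP : ∀ x, 0 ≤ P x)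
    (h : ∀ x y, 0 < G.b x y → (f x - f y) ^ 2 ≤ K * ρ x y ^ 2 * (P x + P y)) :
    G.energy f ≤ ENNReal.ofReal (2 * K) * ∫⁻ x, ENNReal.ofReal (P x) ∂G.m := by
  set F : X × X → ℝ≥0∞ := fun p => ENNReal.ofReal (P p.1) *
    ((G.b p.1 p.2 : ℝ≥0∞) * ENNReal.ofReal (ρ p.1 p.2 ^ 2)) with hF
  have h1 : ∀ p : X × X, (G.b p.1 p.2 : ℝ≥0∞) * ENNReal.ofReal ((f p.1 - f p.2) ^ 2) ≤
      ENNReal.ofReal K * (F p + F p.swap) := by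
    rintro ⟨x, y⟩
    rcases (zero_le (a := G.b x y)).eq_or_lt with h0 | h0
    · simp [← h0]
    · have h2 := ENNReal.ofReal_le_ofReal (h x y h0)
      rw [ENNReal.ofReal_mul (by positivity), ENNReal.ofReal_mul hK,
        ENNReal.ofReal_add (hP x) (hP y)] at h2
      refine (mul_le_mul_right h2 (G.b x y : ℝ≥0∞)).trans_eq ?_
      simp only [hF, Prod.swap, G.b_symm y x, PseudoMetric.symm ρ y x]
      ring
  have hswap : ∑' p : X × X, F p.swap = ∑' p, F p := (Equiv.prodComm X X).tsum_eq F
  have hA : ∑' p, F p ≤ 2 * ∫⁻ x, ENNReal.ofReal (P x) ∂G.m := by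
    rw [ENNReal.tsum_prod', lintegral_countable', ← ENNReal.tsum_mul_left]
    refine ENNReal.tsum_le_tsum fun x => ?_
    simp only [hF, ENNReal.tsum_mul_left]
    have h3 := mul_le_mul_right (hρ x) 2
    rw [← mul_assoc, ENNReal.mul_inv_cancel (by norm_num) (by norm_num), one_mul] at h3
    exact (mul_le_mul_right h3 _).trans_eq (by ring)
  calc G.energy f ≤ 2⁻¹ * ∑' p : X × X, ENNReal.ofReal K * (F p + F p.swap) :=
        mul_le_mul_right (ENNReal.tsum_le_tsum h1) _
    _ = (2⁻¹ * 2) * (ENNReal.ofReal K * ∑' p, F p) := by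
        rw [ENNReal.tsum_mul_left, ENNReal.tsum_add, hswap]
        ring
    _ ≤ ENNReal.ofReal K * (2 * ∫⁻ x, ENNReal.ofReal (P x) ∂G.m) := by
        rw [ENNReal.inv_mul_cancel (by norm_num) (by norm_num), one_mul]
        exact mul_le_mul_right hA _
    _ = _ := by
        rw [ENNReal.ofReal_mul (by norm_num), ENNReal.ofReal_ofNat]
        ring

end WeightedGraph

/-- The function `exp (-α ρ(·, x₀))`, made constant inside the ball of radius `r₁` and outside the
ball of radius `r`, and shifted so that it vanishes outside the latter. -/
def cutoffExp {X : Type*} (ρ : PseudoMetric X ℝ) (x₀ : X) (α r₁ r : ℝ) (y : X) : ℝ :=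
  Real.exp (-(α * min (max (ρ y x₀) r₁) r)) - Real.exp (-(α * r))

section cutoffExp

variable {X : Type*} {ρ : PseudoMetric X ℝ} {x₀ : X} {α r₁ r : ℝ}

theorem cutoffExp_nonneg (hα : 0 ≤ α) (y : X) : 0 ≤ cutoffExp ρ x₀ α r₁ r y :=
  sub_nonneg.2 (Real.exp_le_exp.2 (neg_le_neg (mul_le_mul_of_nonneg_left (min_le_right _ _) hα)))

theorem cutoffExp_eq_zero {y : X} (hy : r ≤ ρ y x₀) : cutoffExp ρ x₀ α r₁ r y = 0 := by
  rw [cutoffExp, min_eq_right (hy.trans (le_max_left _ _)), sub_self]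

theorem cutoffExp_le (hα : 0 ≤ α) (hr : r₁ ≤ r) (y : X) :
    cutoffExp ρ x₀ α r₁ r y ≤ Real.exp (-(α * r₁)) := by
  refine (sub_le_self _ (Real.exp_pos _).le).trans (Real.exp_le_exp.2 (neg_le_neg ?_))
  exact mul_le_mul_of_nonneg_left (le_min (le_max_right _ _) hr) hα

theorem cutoffExp_of_le (hr : r₁ ≤ r) {y : X} (hy : ρ y x₀ ≤ r₁) :
    cutoffExp ρ x₀ α r₁ r y = Real.exp (-(α * r₁)) - Real.exp (-(α * r)) := by
  rw [cutoffExp, max_eq_right hy, min_eq_left hr]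

theorem PseudoMetric.abs_sub_le (ρ : PseudoMetric X ℝ) (x y z : X) :
    |ρ x z - ρ y z| ≤ ρ x y := by
  have h1 := ρ.triangle' x y z
  have h2 := ρ.triangle' y x z
  have h3 := ρ.symm' y x
  change ρ x z ≤ ρ x y + ρ y z at h1
  change ρ y z ≤ ρ y x + ρ x z at h2
  change ρ y x = ρ x y at h3
  rw [abs_le]
  constructor <;> linarith

/-- Clipping the distance is 1-Lipschitz, so the edge inequality applies to the unshifted
exponential. On an edge leaving the ball its outer value is `e^{-αr}`; adding that square to the
weight of the inner vertex lets the weight vanish outside the ball, whose volume alone is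
controlled. -/
theorem cutoffExp_sub_sq_le (hα : 0 ≤ α) {x y : X} {K : ℝ} (hK : 0 ≤ K)
    (h : (Real.exp (α * ρ x y) - 1) ^ 2 ≤ K * ρ x y ^ 2 * (Real.exp (2 * (α * ρ x y)) + 1)) :
    (cutoffExp ρ x₀ α r₁ r x - cutoffExp ρ x₀ α r₁ r y) ^ 2 ≤ K * ρ x y ^ 2 *
      ({z | ρ z x₀ ≤ r}.indicator (fun z => (cutoffExp ρ x₀ α r₁ r z + Real.exp (-(α * r))) ^ 2 +
          Real.exp (-(α * r)) ^ 2) x +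
        {z | ρ z x₀ ≤ r}.indicator (fun z => (cutoffExp ρ x₀ α r₁ r z + Real.exp (-(α * r))) ^ 2 +
          Real.exp (-(α * r)) ^ 2) y) := by
  have hlip : |α * min (max (ρ x x₀) r₁) r - α * min (max (ρ y x₀) r₁) r| ≤ α * ρ x y := by
    rw [← mul_sub, abs_mul, abs_of_nonneg hα]
    gcongr
    have h1 := abs_min_sub_min_le_max (max (ρ x x₀) r₁) r (max (ρ y x₀) r₁) r
    have h2 := abs_max_sub_max_le_max (ρ x x₀) r₁ (ρ y x₀) r₁
    rw [sub_self r, abs_zero, max_eq_left (abs_nonneg (max (ρ x x₀) r₁ - max (ρ y x₀) r₁))] at h1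
    rw [sub_self r₁, abs_zero, max_eq_left (abs_nonneg (ρ x x₀ - ρ y x₀))] at h2
    exact h1.trans (h2.trans (ρ.abs_sub_le x y x₀))
  have h1 := exp_neg_sub_sq_le hlip h
  have hc : 0 ≤ K * ρ x y ^ 2 := by positivity
  by_cases hx : ρ x x₀ ≤ r <;> by_cases hy : ρ y x₀ ≤ r
  · rw [Set.indicator_of_mem (by exact hx), Set.indicator_of_mem (by exact hy)]
    simp only [cutoffExp, sub_add_cancel, sub_sub_sub_cancel_right]
    refine h1.trans (mul_le_mul_of_nonneg_left ?_ hc)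
    nlinarith [sq_nonneg (Real.exp (-(α * r)))]
  · rw [Set.indicator_of_mem (by exact hx), Set.indicator_of_notMem (by exact hy), add_zero]
    have h2 : min (max (ρ y x₀) r₁) r = r :=
      min_eq_right ((not_le.1 hy).le.trans (le_max_left _ _))
    simp only [cutoffExp, sub_add_cancel, sub_sub_sub_cancel_right]
    rwa [h2] at h1 ⊢
  · rw [Set.indicator_of_notMem (by exact hx), Set.indicator_of_mem (by exact hy), zero_add,
      add_comm (_ ^ 2)]
    have h2 : min (max (ρ x x₀) r₁) r = r :=
      min_eq_right ((not_le.1 hx).le.trans (le_max_left _ _))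
    simp only [cutoffExp, sub_add_cancel, sub_sub_sub_cancel_right]
    rwa [h2] at h1 ⊢
  · rw [cutoffExp_eq_zero (not_le.1 hx).le, cutoffExp_eq_zero (not_le.1 hy).le,
      Set.indicator_of_notMem (by exact hx), Set.indicator_of_notMem (by exact hy)]
    simp

end cutoffExp

namespace WeightedGraph

variable {X : Type*} [Countable X] [MeasurableSpace X] [DiscreteMeasurableSpace X]
  (G : WeightedGraph X) {ρ : PseudoMetric X ℝ} {x₀ : X} {α r₁ r K ε : ℝ}

theorem energy_cutoffExp_le (hρ : G.IsIntrinsic ρ) (hα : 0 ≤ α) (hK : 0 ≤ K) (hε : 0 < ε)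
    (h : ∀ x y, G.toSimpleGraph.Adj x y →
      (Real.exp (α * ρ x y) - 1) ^ 2 ≤ K * ρ x y ^ 2 * (Real.exp (2 * (α * ρ x y)) + 1)) :
    G.energy (cutoffExp ρ x₀ α r₁ r) ≤ ENNReal.ofReal (2 * K) *
      (ENNReal.ofReal (1 + ε) * G.sqNorm (cutoffExp ρ x₀ α r₁ r) +
        ENNReal.ofReal ((2 + ε⁻¹) * Real.exp (-(α * r)) ^ 2) * G.vol ρ x₀ r) := by
  refine (G.energy_le_of_sq_sub_le hρ hK (fun x => Set.indicator_nonneg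
    (fun z _ => by positivity) x) fun x y hxy => cutoffExp_sub_sq_le hα hK (h x y hxy)).trans ?_
  gcongr
  have hpt : ∀ x, ENNReal.ofReal ({z | ρ z x₀ ≤ r}.indicator (fun z =>
      (cutoffExp ρ x₀ α r₁ r z + Real.exp (-(α * r))) ^ 2 + Real.exp (-(α * r)) ^ 2) x) ≤
      ENNReal.ofReal (1 + ε) * ENNReal.ofReal (cutoffExp ρ x₀ α r₁ r x ^ 2) +
        {z | ρ z x₀ ≤ r}.indicator
          (fun _ => ENNReal.ofReal ((2 + ε⁻¹) * Real.exp (-(α * r)) ^ 2)) x := by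
    intro x
    by_cases hx : ρ x x₀ ≤ r
    · rw [Set.indicator_of_mem (by exact hx), Set.indicator_of_mem (by exact hx),
        ← ENNReal.ofReal_mul (by positivity), ← ENNReal.ofReal_add (by positivity) (by positivity)]
      refine ENNReal.ofReal_le_ofReal ?_
      set a := cutoffExp ρ x₀ α r₁ r x
      set d := Real.exp (-(α * r))
      -- Young's inequality in the form `(a + d)² + d² ≤ (1 + ε) a² + (2 + ε⁻¹) d²`.
      have h1 : 0 ≤ ε * (a - ε⁻¹ * d) ^ 2 := by positivity
      have h2 : ε * (a - ε⁻¹ * d) ^ 2 = ε * a ^ 2 - 2 * a * d + ε⁻¹ * d ^ 2 := by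
        field_simp
        ring
      nlinarith
    · rw [Set.indicator_of_notMem (by exact hx)]
      simp
  refine (lintegral_mono hpt).trans_eq ?_
  rw [lintegral_add_left Measurable.of_discrete, lintegral_const_mul _ Measurable.of_discrete,
    lintegral_indicator MeasurableSet.of_discrete, setLIntegral_const]
  rfl

omit [Countable X] in
-- The condition `hr` says that the subtracted outer value is at most half of the inner one, so at
-- least `e^{-αr₁}/2` remains on the inner ball.
theorem mul_vol_le_sqNorm_cutoffExp (hr : 2 ≤ Real.exp (α * (r - r₁))) (hrr : r₁ ≤ r) :
    ENNReal.ofReal (Real.exp (-(α * r₁)) ^ 2 / 4) * G.vol ρ x₀ r₁ ≤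
      G.sqNorm (cutoffExp ρ x₀ α r₁ r) := by
  have h1 : Real.exp (-(α * r)) * Real.exp (α * (r - r₁)) = Real.exp (-(α * r₁)) := by
    rw [← Real.exp_add]
    ring_nf
  have h2 : Real.exp (-(α * r₁)) ^ 2 / 4 ≤
      (Real.exp (-(α * r₁)) - Real.exp (-(α * r))) ^ 2 := by
    have h3 : Real.exp (-(α * r)) * 2 ≤ Real.exp (-(α * r₁)) := by
      rw [← h1]
      gcongr
    have := pow_le_pow_left₀ (by positivity) (show Real.exp (-(α * r₁)) / 2 ≤
      Real.exp (-(α * r₁)) - Real.exp (-(α * r)) by linarith) 2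
    linarith
  calc _ = ∫⁻ _ in {y | ρ y x₀ ≤ r₁}, ENNReal.ofReal (Real.exp (-(α * r₁)) ^ 2 / 4) ∂G.m := by
        rw [setLIntegral_const]
        rfl
    _ ≤ ∫⁻ y in {y | ρ y x₀ ≤ r₁}, ENNReal.ofReal (cutoffExp ρ x₀ α r₁ r y ^ 2) ∂G.m := by
        refine setLIntegral_mono' MeasurableSet.of_discrete fun y hy => ?_
        rw [cutoffExp_of_le hrr hy]
        exact ENNReal.ofReal_le_ofReal h2
    _ ≤ _ := setLIntegral_le_lintegral _ _

omit [Countable X] in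
theorem sqNorm_cutoffExp_ne_top (hα : 0 ≤ α) (hrr : r₁ ≤ r) (hvol : G.vol ρ x₀ r ≠ ∞) :
    G.sqNorm (cutoffExp ρ x₀ α r₁ r) ≠ ∞ := by
  have h1 : G.sqNorm (cutoffExp ρ x₀ α r₁ r) ≤
      ENNReal.ofReal (Real.exp (-(α * r₁)) ^ 2) * G.vol ρ x₀ r := by
    calc _ ≤ ∫⁻ y, {y | ρ y x₀ ≤ r}.indicator
          (fun _ => ENNReal.ofReal (Real.exp (-(α * r₁)) ^ 2)) y ∂G.m := by
          refine lintegral_mono fun y => ?_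
          by_cases hy : ρ y x₀ ≤ r
          · rw [Set.indicator_of_mem (by exact hy)]
            exact ENNReal.ofReal_le_ofReal
              (pow_le_pow_left₀ (cutoffExp_nonneg hα y) (cutoffExp_le hα hrr y) 2)
          · rw [cutoffExp_eq_zero (not_le.1 hy).le]
            simp
      _ = _ := by
          rw [lintegral_indicator MeasurableSet.of_discrete, setLIntegral_const]
          rfl
  exact (h1.trans_lt (ENNReal.mul_lt_top ENNReal.ofReal_lt_top (lt_top_iff_ne_top.2 hvol))).ne

omit [Countable X] [DiscreteMeasurableSpace X] in
theorem vol_pos (ρ : PseudoMetric X ℝ) (x : X) {r : ℝ} (hr : 0 ≤ r) : 0 < G.vol ρ x r := by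
  refine (G.m_pos x).trans_le (measure_mono ?_)
  rintro _ rfl
  exact (ρ.refl' _).trans_le hr

/-- The `4` in `hvol` cancels that of `mul_vol_le_sqNorm_cutoffExp`, making the boundary error at
most `ε² ‖f‖²`. Then `(1 + ε) + (2 + ε⁻¹) ε² = 1 + 2ε + 2ε²`. -/
theorem energy_cutoffExp_le_mul_sqNorm (hρ : G.IsIntrinsic ρ) (hα : 0 ≤ α) (hK : 0 ≤ K)
    (hε : 0 < ε) (h : ∀ x y, G.toSimpleGraph.Adj x y →
      (Real.exp (α * ρ x y) - 1) ^ 2 ≤ K * ρ x y ^ 2 * (Real.exp (2 * (α * ρ x y)) + 1))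
    (hr : 2 ≤ Real.exp (α * (r - r₁))) (hrr : r₁ ≤ r)
    (hvol : G.vol ρ x₀ r ≤
      ENNReal.ofReal (ε ^ 2 / 4 * Real.exp (2 * (α * (r - r₁)))) * G.vol ρ x₀ r₁) :
    G.energy (cutoffExp ρ x₀ α r₁ r) ≤
      ENNReal.ofReal (2 * K * (1 + 2 * ε + 2 * ε ^ 2)) * G.sqNorm (cutoffExp ρ x₀ α r₁ r) := by
  have h1 : ENNReal.ofReal (Real.exp (-(α * r)) ^ 2) * G.vol ρ x₀ r ≤
      ENNReal.ofReal (ε ^ 2) * G.sqNorm (cutoffExp ρ x₀ α r₁ r) := by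
    calc _ ≤ ENNReal.ofReal (Real.exp (-(α * r)) ^ 2) *
          (ENNReal.ofReal (ε ^ 2 / 4 * Real.exp (2 * (α * (r - r₁)))) * G.vol ρ x₀ r₁) :=
          mul_le_mul_right hvol _
      _ = ENNReal.ofReal (ε ^ 2) *
          (ENNReal.ofReal (Real.exp (-(α * r₁)) ^ 2 / 4) * G.vol ρ x₀ r₁) := by
          rw [← mul_assoc, ← mul_assoc (ENNReal.ofReal (ε ^ 2)), ← ENNReal.ofReal_mul (by positivity),
            ← ENNReal.ofReal_mul (by positivity)]
          congr 2
          have h2 : Real.exp (-(α * r₁)) ^ 2 =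
              Real.exp (-(α * r)) ^ 2 * Real.exp (2 * (α * (r - r₁))) := by
            rw [← Real.exp_nat_mul, ← Real.exp_nat_mul, ← Real.exp_add]
            push_cast
            ring_nf
          rw [h2]
          ring
      _ ≤ _ := by
          gcongr
          exact G.mul_vol_le_sqNorm_cutoffExp hr hrr
  refine (G.energy_cutoffExp_le hρ hα hK hε h).trans ?_
  calc _ ≤ ENNReal.ofReal (2 * K) *
        (ENNReal.ofReal (1 + ε) * G.sqNorm (cutoffExp ρ x₀ α r₁ r) +
        ENNReal.ofReal (2 + ε⁻¹) * (ENNReal.ofReal (ε ^ 2) *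
          G.sqNorm (cutoffExp ρ x₀ α r₁ r))) := by
        rw [ENNReal.ofReal_mul (p := 2 + ε⁻¹) (by positivity), mul_assoc (ENNReal.ofReal (2 + ε⁻¹))]
        gcongr
    _ = _ := by
        rw [← mul_assoc (ENNReal.ofReal (2 + ε⁻¹)), ← add_mul,
          ← ENNReal.ofReal_mul (by positivity), ← ENNReal.ofReal_add (by positivity) (by positivity),
          ← mul_assoc, ← ENNReal.ofReal_mul (by positivity)]
        congr 2
        field_simp
        ring

end WeightedGraph

/-! ### Limit in the exponent and volume growth. -/

/-- Choosing the error parameter `ε = α - a` leaves a single limit `α ↓ a`. -/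
theorem le_coe_of_forall_gt {x : EReal} {K : ℝ → ℝ} {a : ℝ} (hK : ContinuousAt K a)
    (h : ∀ α > a, x ≤ ((2 * K α * (1 + 2 * (α - a) + 2 * (α - a) ^ 2) : ℝ) : EReal)) :
    x ≤ ((2 * K a : ℝ) : EReal) := by
  have h1 : ContinuousAt (fun α => 2 * K α * (1 + 2 * (α - a) + 2 * (α - a) ^ 2)) a := by fun_prop
  have h2 : Tendsto (fun α => ((2 * K α * (1 + 2 * (α - a) + 2 * (α - a) ^ 2) : ℝ) : EReal))
      (𝓝[>] a) (𝓝 ((2 * K a : ℝ) : EReal)) := by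
    have := (continuous_coe_real_ereal.continuousAt.comp h1).tendsto.mono_left
      (nhdsWithin_le_nhds (s := Set.Ioi a))
    simpa only [sub_self, mul_zero, add_zero, mul_one, ne_eq, OfNat.ofNat_ne_zero,
      not_false_eq_true, zero_pow, Function.comp_def] using this
  exact ge_of_tendsto h2 (by filter_upwards [self_mem_nhdsWithin] with α hα using h α hα)

/-- A function that grows by a factor `η e ^ (2 α R)` from `R` to `2 R` is bounded below by
`e ^ (2 α r)` up to a polynomial factor. -/
theorem exists_le_mul_exp_mul_pow {V : ℝ → ℝ} (hV : Monotone V) {R₀ α η : ℝ} (hR₀ : 0 < R₀)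
    (hV0 : 0 < V R₀) (hα : 0 ≤ α) (hη : 0 < η)
    (h : ∀ R ≥ R₀, η * Real.exp (2 * α * R) * V R ≤ V (2 * R)) :
    ∃ p : ℕ, ∃ c > 0, ∀ r ≥ R₀, c ≤ V r * Real.exp (-(2 * α * r)) * r ^ p := by
  -- Doubling the radius multiplies `r ^ p` by `2 ^ p ≥ η⁻¹`, which makes up for the loss of `η`.
  -- The bound thus propagates from `[R₀, 2R₀]` through the dyadic scales.
  obtain ⟨p, hp⟩ := pow_unbounded_of_one_lt η⁻¹ (one_lt_two (α := ℝ))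
  have hp' : 1 ≤ η * 2 ^ p := by
    have := mul_le_mul_of_nonneg_left hp.le hη.le
    rwa [mul_inv_cancel₀ hη.ne'] at this
  refine ⟨p, V R₀ * Real.exp (-(2 * α * (2 * R₀))) * R₀ ^ p, by positivity, ?_⟩
  have hbase : ∀ r, R₀ ≤ r → r ≤ 2 * R₀ → V R₀ * Real.exp (-(2 * α * (2 * R₀))) * R₀ ^ p ≤
      V r * Real.exp (-(2 * α * r)) * r ^ p := by
    intro r h1 h2
    have h3 := hV h1
    have h4 : 0 ≤ V r := hV0.le.trans h3
    gcongr
  have hind : ∀ n : ℕ, ∀ r, R₀ ≤ r → r ≤ 2 ^ (n + 1) * R₀ →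
      V R₀ * Real.exp (-(2 * α * (2 * R₀))) * R₀ ^ p ≤
        V r * Real.exp (-(2 * α * r)) * r ^ p := by
    intro n
    induction n with
    | zero => simpa using hbase
    | succ n ih =>
      intro r h1 h2
      rcases le_total r (2 * R₀) with h3 | h3
      · exact hbase r h1 h3
      · have h4 : R₀ ≤ r / 2 := by linarith
        have h5 := ih (r / 2) h4 (by rw [pow_succ] at h2; linarith)
        have h6 := h (r / 2) h4
        rw [mul_div_cancel₀ r two_ne_zero] at h6
        have hr : 0 < r := by linarith
        have hVr : 0 ≤ V (r / 2) := hV0.le.trans (hV h4)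
        have hexp : Real.exp (2 * α * (r / 2)) * Real.exp (-(2 * α * r)) =
            Real.exp (-(2 * α * (r / 2))) := by
          rw [← Real.exp_add]
          ring_nf
        refine h5.trans ?_
        calc V (r / 2) * Real.exp (-(2 * α * (r / 2))) * (r / 2) ^ p
            ≤ η * 2 ^ p * (V (r / 2) * Real.exp (-(2 * α * (r / 2))) * (r / 2) ^ p) :=
              le_mul_of_one_le_left (by positivity) hp'
          _ = η * Real.exp (2 * α * (r / 2)) * V (r / 2) * Real.exp (-(2 * α * r)) * r ^ p := by
              rw [← hexp, div_pow]
              field_simp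
          _ ≤ _ := by gcongr
  intro r hr
  obtain ⟨n, hn⟩ := pow_unbounded_of_one_lt (r / R₀) (one_lt_two (α := ℝ))
  refine hind n r hr ?_
  rw [div_lt_iff₀ hR₀] at hn
  refine hn.le.trans ?_
  gcongr
  · norm_num
  · exact n.le_succ

theorem lt_ofReal_exp_of_log_div_lt {V : ℝ≥0∞} {r β : ℝ} (hr : 0 < r)
    (h : ENNReal.log V / (r : EReal) < β) : V < ENNReal.ofReal (Real.exp (β * r)) := by
  rw [EReal.div_lt_iff (by exact_mod_cast hr) (EReal.coe_ne_top r)] at h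
  rw [← ENNReal.log_lt_log_iff, ENNReal.log_ofReal_of_pos (Real.exp_pos _), Real.log_exp]
  exact_mod_cast h

theorem EReal.eq_coe_or_eq_top_of_nonneg {s : EReal} (hs : 0 ≤ s) :
    (∃ a : ℝ, 0 ≤ a ∧ s = a) ∨ s = ⊤ := by
  induction s with
  | bot => simp at hs
  | coe a => exact Or.inl ⟨a, by exact_mod_cast hs, rfl⟩
  | top => exact Or.inr rfl

theorem EReal.top_sq_div_four : (⊤ : EReal) ^ 2 / 4 = ⊤ := by
  rw [pow_two, EReal.top_mul_top]
  exact EReal.top_div_of_pos_ne_top (by norm_num) (by decide)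

theorem EReal.coe_sq_div_four (a : ℝ) : (a : EReal) ^ 2 / 4 = ((a ^ 2 / 4 : ℝ) : EReal) := by
  rw [EReal.coe_div, EReal.coe_pow]
  rfl

namespace WeightedGraph

section Volume

variable {X : Type*} [MeasurableSpace X] (G : WeightedGraph X) (ρ : PseudoMetric X ℝ) (x₀ : X)

theorem vol_mono : Monotone (G.vol ρ x₀) := fun _ _ h => measure_mono fun _ hy => le_trans hy h

theorem tendsto_vol_atTop : Tendsto (G.vol ρ x₀) atTop (𝓝 (G.m Set.univ)) := by
  have h := tendsto_measure_iUnion_atTop (μ := G.m) (s := fun r : ℝ => {y | ρ y x₀ ≤ r})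
    fun _ _ h _ hy => le_trans hy h
  rwa [Set.iUnion_eq_univ_iff.2 fun y => ⟨ρ y x₀, le_refl (ρ y x₀)⟩] at h

theorem volGrowth_nonneg (hinf : G.m Set.univ = ∞) : 0 ≤ G.volGrowth ρ x₀ := by
  refine le_liminf_of_le (h := ?_)
  have h := G.tendsto_vol_atTop ρ x₀
  rw [hinf] at h
  filter_upwards [Tendsto.eventually_const_le (show (1 : ℝ≥0∞) < ∞ by simp) h, eventually_ge_atTop 0]
    with r hr hr0
  exact EReal.div_nonneg (ENNReal.zero_le_log_iff.2 hr) (by exact_mod_cast hr0)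

theorem minVolGrowth_nonneg : 0 ≤ G.minVolGrowth ρ := by
  refine le_liminf_of_le (h := ?_)
  filter_upwards [eventually_ge_atTop 1] with r hr
  refine EReal.div_nonneg (le_iInf fun x => le_iInf fun hx => ?_)
    (by exact_mod_cast zero_le_one.trans hr)
  rw [ENNReal.zero_le_log_iff,
    ENNReal.le_div_iff_mul_le (Or.inl (G.vol_pos ρ x zero_le_one).ne') (Or.inl hx.ne), one_mul]
  exact G.vol_mono ρ x hr

variable {ρ x₀}

theorem vol_ne_top_of_volGrowth_lt {β : ℝ} (h : G.volGrowth ρ x₀ < β) (r : ℝ) :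
    G.vol ρ x₀ r ≠ ∞ := by
  obtain ⟨s, hs, hs'⟩ := ((frequently_lt_of_liminf_lt (h := h)).and_eventually
    (eventually_gt_atTop (max r 0))).exists
  have h1 := lt_ofReal_exp_of_log_div_lt ((le_max_right _ _).trans_lt hs') hs
  exact ((G.vol_mono ρ x₀ ((le_max_left _ _).trans hs'.le)).trans_lt
    (h1.trans ENNReal.ofReal_lt_top)).ne

/-- If the exponential volume growth is smaller than `2 α`, then there are large radii `R` for which
`m(B_{2R})` is much smaller than `e ^ (2 α R) m(B_R)`. -/
theorem exists_vol_two_mul_le {α : ℝ} (hα : 0 ≤ α) (h : G.volGrowth ρ x₀ < (2 * α : ℝ)) {η : ℝ}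
    (hη : 0 < η) (R₀ : ℝ) : ∃ R ≥ R₀, G.vol ρ x₀ (2 * R) ≤
      ENNReal.ofReal (η * Real.exp (2 * α * R)) * G.vol ρ x₀ R := by
  -- Otherwise the volume is at least `c e^{2αr} r^{-p}` for all large `r`, against `m(B_r) <
  -- e^{βr}` at arbitrarily large radii with `β < 2α`.
  by_contra! hcon
  obtain ⟨β, hβ, hβα⟩ := EReal.lt_iff_exists_real_btwn.1 h
  have hβα' : β < 2 * α := by exact_mod_cast hβα
  have hfin := G.vol_ne_top_of_volGrowth_lt hβ
  set V : ℝ → ℝ := fun r => (G.vol ρ x₀ r).toReal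
  have hmono : Monotone V := fun r s hrs => ENNReal.toReal_mono (hfin s) (G.vol_mono ρ x₀ hrs)
  have hR₁ : 0 < max R₀ 1 := lt_max_of_lt_right one_pos
  obtain ⟨p, c, hc, hV⟩ := exists_le_mul_exp_mul_pow hmono hR₁
    (ENNReal.toReal_pos (G.vol_pos ρ x₀ hR₁.le).ne' (hfin _)) hα hη fun R hR => by
      have := ENNReal.toReal_mono (hfin _) (hcon R ((le_max_left _ _).trans hR)).le
      rwa [ENNReal.toReal_mul, ENNReal.toReal_ofReal (by positivity)] at this
  have hb : 0 < 2 * α - β := by linarith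
  have hlit := (isLittleO_pow_exp_pos_mul_atTop p hb).def (half_pos hc)
  obtain ⟨r, hr, hrlit, hrR⟩ := ((frequently_lt_of_liminf_lt (h := hβ)).and_eventually
    (hlit.and (eventually_ge_atTop (max R₀ 1)))).exists
  have hr0 : 0 < r := hR₁.trans_le hrR
  have h1 : V r ≤ Real.exp (β * r) := by
    have := ENNReal.toReal_mono ENNReal.ofReal_ne_top (lt_ofReal_exp_of_log_div_lt hr0 hr).le
    rwa [ENNReal.toReal_ofReal (by positivity)] at this
  rw [Real.norm_of_nonneg (by positivity), Real.norm_of_nonneg (by positivity)] at hrlit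
  have h2 : c ≤ Real.exp (β * r) * Real.exp (-(2 * α * r)) *
      (c / 2 * Real.exp ((2 * α - β) * r)) := (hV r hrR).trans (by gcongr)
  have h3 : Real.exp (β * r) * Real.exp (-(2 * α * r)) * Real.exp ((2 * α - β) * r) = 1 := by
    rw [← Real.exp_add, ← Real.exp_add, Real.exp_eq_one_iff]
    ring
  have h4 : Real.exp (β * r) * Real.exp (-(2 * α * r)) * (c / 2 * Real.exp ((2 * α - β) * r)) =
    c / 2 := by linear_combination (c / 2) * h3
  linarith

end Volume

/-! ### The estimates for finite volume growth. -/

variable {X : Type*} [Countable X] [MeasurableSpace X] [DiscreteMeasurableSpace X]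
  (G : WeightedGraph X) {ρ : PseudoMetric X ℝ} {K : ℝ → ℝ} {a : ℝ}

theorem specBottom_Lmax_le_of_minVolGrowth_eq (hρ : G.IsIntrinsic ρ) (hK : ∀ α, 0 ≤ K α)
    (hKc : Continuous K) (h : ∀ α > 0, ∀ x y, G.toSimpleGraph.Adj x y →
      (Real.exp (α * ρ x y) - 1) ^ 2 ≤ K α * ρ x y ^ 2 * (Real.exp (2 * (α * ρ x y)) + 1))
    (ha : 0 ≤ a) (hvol : G.minVolGrowth ρ = a) :
    specBottom G.Lmax ≤ ((2 * K (a / 2) : ℝ) : EReal) := by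
  refine le_coe_of_forall_gt hKc.continuousAt fun α hα => ?_
  have hα0 : 0 < α := by linarith
  set ε := α - a / 2
  have hε : 0 < ε := sub_pos.2 hα
  obtain ⟨β, hβ, hβα⟩ := exists_between (show a < 2 * α by linarith)
  have hlt : G.minVolGrowth ρ < β := by
    rw [hvol]
    exact_mod_cast hβ
  have hb : 0 < 2 * α - β := by linarith
  have hexp : Tendsto (fun r : ℝ => Real.exp ((2 * α - β) * r)) atTop atTop :=
    Real.tendsto_exp_atTop.comp (tendsto_id.const_mul_atTop hb)
  -- The first size condition turns `e^{βr}` into `(ε²/4) e^{2α(r-1)}`; the second gives `α (r - 1)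
  -- ≥ 1`, so that `e^{α(r-1)} ≥ 2`.
  obtain ⟨r, hr, hr1, hr2⟩ := ((frequently_lt_of_liminf_lt (h := hlt)).and_eventually
    ((hexp.eventually_ge_atTop (4 / ε ^ 2 * Real.exp (2 * α))).and
      (eventually_ge_atTop (1 + 1 / α)))).exists
  have hr0 : 0 < r := lt_of_lt_of_le (by positivity) hr2
  have h1r : 1 ≤ r := le_trans (by simpa using (one_div_pos.2 hα0).le) hr2
  rw [EReal.div_lt_iff (by exact_mod_cast hr0) (EReal.coe_ne_top r), iInf_lt_iff] at hr
  -- The centre depends on `r`, which is harmless because a single test function suffices for the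
  -- bottom of the spectrum.
  obtain ⟨x, hx⟩ := hr
  rw [iInf_lt_iff] at hx
  obtain ⟨hx1, hx⟩ := hx
  have hx0 := (G.vol_pos ρ x zero_le_one).ne'
  have hvx : G.vol ρ x r ≤ ENNReal.ofReal (Real.exp (β * r)) * G.vol ρ x 1 := by
    rw [← ENNReal.div_le_iff hx0 hx1.ne]
    refine le_of_lt ?_
    rw [← ENNReal.log_lt_log_iff, ENNReal.log_ofReal_of_pos (Real.exp_pos _), Real.log_exp]
    exact_mod_cast hx
  have hvx' : G.vol ρ x r ≤
      ENNReal.ofReal (ε ^ 2 / 4 * Real.exp (2 * (α * (r - 1)))) * G.vol ρ x 1 := by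
    refine hvx.trans ?_
    gcongr
    have h1 : Real.exp (2 * (α * (r - 1))) =
        Real.exp (β * r) * Real.exp ((2 * α - β) * r) * Real.exp (-(2 * α)) := by
      rw [← Real.exp_add, ← Real.exp_add]
      ring_nf
    have h2 : Real.exp (2 * α) * Real.exp (-(2 * α)) = 1 := by
      rw [← Real.exp_add, add_neg_cancel, Real.exp_zero]
    rw [h1]
    calc Real.exp (β * r) = ε ^ 2 / 4 * (Real.exp (β * r) *
          (4 / ε ^ 2 * Real.exp (2 * α)) * Real.exp (-(2 * α))) := by
          rw [mul_assoc (Real.exp (β * r)), mul_assoc (4 / ε ^ 2), h2]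
          field_simp
      _ ≤ _ := by gcongr
  have hr' : 2 ≤ Real.exp (α * (r - 1)) := by
    have h1 : 1 ≤ α * (r - 1) := by
      rw [← div_le_iff₀' hα0]
      linarith
    linarith [Real.add_one_le_exp (α * (r - 1))]
  have hvfin : G.vol ρ x r ≠ ∞ :=
    (hvx.trans_lt (ENNReal.mul_lt_top ENNReal.ofReal_lt_top hx1)).ne
  refine G.specBottom_Lmax_le (f := cutoffExp ρ x α 1 r) ?_
    (G.sqNorm_cutoffExp_ne_top hα0.le h1r hvfin) ?_
    (G.energy_cutoffExp_le_mul_sqNorm hρ hα0.le (hK α) hε (h α hα0) hr' h1r hvx')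
  · refine (lt_of_lt_of_le ?_ (G.mul_vol_le_sqNorm_cutoffExp hr' h1r)).ne'
    exact ENNReal.mul_pos (ENNReal.ofReal_pos.2 (by positivity)).ne' hx0
  · have := hK α
    positivity

theorem essSpecBottom_Lmax_le_of_volGrowth_eq (hinf : G.m Set.univ = ∞) (hρ : G.IsIntrinsic ρ)
    (hK : ∀ α, 0 ≤ K α) (hKc : Continuous K) (h : ∀ α > 0, ∀ x y, G.toSimpleGraph.Adj x y →
      (Real.exp (α * ρ x y) - 1) ^ 2 ≤ K α * ρ x y ^ 2 * (Real.exp (2 * (α * ρ x y)) + 1))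
    (ha : 0 ≤ a) {x₀ : X} (hvol : G.volGrowth ρ x₀ = a) :
    essSpecBottom G.Lmax ≤ ((2 * K (a / 2) : ℝ) : EReal) := by
  refine le_coe_of_forall_gt hKc.continuousAt fun α hα => ?_
  have hα0 : 0 < α := by linarith
  set ε := α - a / 2
  have hε : 0 < ε := sub_pos.2 hα
  have hlt : G.volGrowth ρ x₀ < (2 * α : ℝ) := by
    rw [hvol]
    exact EReal.coe_lt_coe_iff.2 (by linarith)
  have hfin := G.vol_ne_top_of_volGrowth_lt hlt
  -- Radii beyond `k` force `R k → ∞`; radii beyond `1/α` give `e^{α R k} ≥ 2`.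
  choose R hR hRvol using fun k : ℕ => G.exists_vol_two_mul_le hα0.le hlt
    (η := ε ^ 2 / 4) (by positivity) (max k (1 / α))
  have hRα (k) : 1 / α ≤ R k := (le_max_right _ _).trans (hR k)
  have hR0 (k) : 0 < R k := (one_div_pos.2 hα0).trans_le (hRα k)
  have hRtop : Tendsto R atTop atTop :=
    tendsto_atTop_mono (fun k => (le_max_left _ _).trans (hR k)) tendsto_natCast_atTop_atTop
  have hRR (k) : R k ≤ 2 * R k := by linarith [hR0 k]
  have hexp (k) : 2 ≤ Real.exp (α * (2 * R k - R k)) := by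
    have h1 : 1 ≤ α * (2 * R k - R k) := by
      rw [← div_le_iff₀' hα0]
      linarith [hRα k]
    linarith [Real.add_one_le_exp (α * (2 * R k - R k))]
  have hvol' (k) : G.vol ρ x₀ (2 * R k) ≤
      ENNReal.ofReal (ε ^ 2 / 4 * Real.exp (2 * (α * (2 * R k - R k)))) * G.vol ρ x₀ (R k) := by
    refine (hRvol k).trans_eq ?_
    ring_nf
  have hlow (k) := G.mul_vol_le_sqNorm_cutoffExp (ρ := ρ) (x₀ := x₀) (hexp k) (hRR k)
  have htop (k) := G.sqNorm_cutoffExp_ne_top hα0.le (hRR k) (hfin (2 * R k))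
  refine G.essSpecBottom_Lmax_le (f := fun k => cutoffExp ρ x₀ α (R k) (2 * R k))
    (fun k => ?_) htop ?_ (fun k => G.energy_cutoffExp_le_mul_sqNorm hρ hα0.le (hK α) hε (h α hα0)
      (hexp k) (hRR k) (hvol' k)) fun x => ?_
  · exact (lt_of_lt_of_le (ENNReal.mul_pos (ENNReal.ofReal_pos.2 (by positivity)).ne'
      (G.vol_pos ρ x₀ (hR0 k).le).ne') (hlow k)).ne'
  · have := hK α
    positivity
  · set V : ℕ → ℝ := fun k => (G.vol ρ x₀ (R k)).toReal
    have hVtop : Tendsto V atTop atTop := by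
      have h1 := (G.tendsto_vol_atTop ρ x₀).comp hRtop
      rw [hinf] at h1
      refine tendsto_atTop.2 fun B => ?_
      filter_upwards [Tendsto.eventually_const_lt (show ENNReal.ofReal B < ∞ by simp) h1] with k hk
      exact (ENNReal.ofReal_le_iff_le_toReal (hfin _)).1 hk.le
    have hV (k) : 0 < V k := ENNReal.toReal_pos (G.vol_pos ρ x₀ (hR0 k).le).ne' (hfin _)
    -- The function is at most `e^{-αR}` and its norm at least `e^{-αR} √m(B_R) / 2`. The
    -- exponentials cancel, and `m(B_R) → ∞` drives the quotient to zero.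
    refine squeeze_zero (fun k => mul_nonneg (by positivity) (cutoffExp_nonneg hα0.le x))
      (g := fun k => 2 * (√(V k))⁻¹) (fun k => ?_) ?_
    · have h1 := ENNReal.toReal_mono (htop k) (hlow k)
      rw [ENNReal.toReal_mul, ENNReal.toReal_ofReal (by positivity)] at h1
      have h2 : Real.exp (-(α * R k)) / 2 * √(V k) ≤
          √(G.sqNorm (cutoffExp ρ x₀ α (R k) (2 * R k))).toReal := by
        refine Real.le_sqrt_of_sq_le (le_trans (le_of_eq ?_) h1)
        rw [mul_pow, Real.sq_sqrt (hV k).le]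
        ring
      have h3 : 0 < √(V k) := Real.sqrt_pos.2 (hV k)
      calc _ ≤ (Real.exp (-(α * R k)) / 2 * √(V k))⁻¹ * Real.exp (-(α * R k)) := by
            gcongr
            · exact cutoffExp_nonneg hα0.le x
            · exact cutoffExp_le hα0.le (hRR k) x
        _ = _ := by field_simp
    · have h1 : Tendsto (fun k => (√(V k))⁻¹) atTop (𝓝 0) :=
        tendsto_inv_atTop_zero.comp (Real.tendsto_sqrt_atTop.comp hVtop)
      simpa using h1.const_mul 2

/-! ### Infinite volume growth: indicators of points. -/

section Single

variable {δ : ℝ}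

omit [Countable X] in
theorem sqNorm_indicator_singleton (x : X) :
    G.sqNorm (({x} : Set X).indicator fun _ => 1) = G.m {x} := by
  have h : ∀ y, ENNReal.ofReal (({x} : Set X).indicator (fun _ => (1 : ℝ)) y ^ 2) =
      ({x} : Set X).indicator (fun _ => 1) y := by
    intro y
    by_cases hy : y ∈ ({x} : Set X) <;> simp [hy]
  rw [sqNorm, lintegral_congr h, lintegral_indicator MeasurableSet.of_discrete,
    setLIntegral_const, one_mul]

/-- On every edge `1 ≤ ρ²/δ²`, so `K = 1/δ²` works with the indicator itself as weight. -/
theorem energy_indicator_singleton_le (hρ : G.IsIntrinsic ρ) (hδ : 0 < δ)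
    (h : ∀ x y : X, G.toSimpleGraph.Adj x y → ρ x y ∈ Set.Icc δ 1) (x : X) :
    G.energy (({x} : Set X).indicator fun _ => 1) ≤
      ENNReal.ofReal (2 / δ ^ 2) * G.sqNorm (({x} : Set X).indicator fun _ => 1) := by
  have h0 : ∀ y, ({x} : Set X).indicator (fun _ => (1 : ℝ)) y ^ 2 =
      ({x} : Set X).indicator (fun _ => (1 : ℝ)) y := by
    intro y
    by_cases hy : y ∈ ({x} : Set X) <;> simp [hy]
  have hnn : ∀ y, 0 ≤ ({x} : Set X).indicator (fun _ => (1 : ℝ)) y := fun y =>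
    Set.indicator_nonneg (fun _ _ => zero_le_one) y
  have h1 := G.energy_le_of_sq_sub_le hρ (K := 1 / δ ^ 2) (by positivity) (P := fun y =>
    ({x} : Set X).indicator (fun _ => 1) y) (f := ({x} : Set X).indicator fun _ => 1) hnn
    fun y z hyz => by
      have h2 : 1 ≤ 1 / δ ^ 2 * ρ y z ^ 2 := by
        rw [one_div, ← div_eq_inv_mul, one_le_div (by positivity)]
        exact pow_le_pow_left₀ hδ.le (h y z hyz).1 2
      have h3 := add_nonneg (hnn y) (hnn z)
      refine le_trans ?_ (le_mul_of_one_le_left h3 h2)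
      have := h0 y
      have := h0 z
      nlinarith [mul_nonneg (hnn y) (hnn z)]
  refine h1.trans_eq ?_
  simp only [sqNorm, h0]
  congr 2
  ring

theorem specBottom_Lmax_le_two_div_sq (hρ : G.IsIntrinsic ρ) (hδ : 0 < δ)
    (h : ∀ x y : X, G.toSimpleGraph.Adj x y → ρ x y ∈ Set.Icc δ 1) (x : X) :
    specBottom G.Lmax ≤ ((2 / δ ^ 2 : ℝ) : EReal) := by
  refine G.specBottom_Lmax_le ?_ ?_ (by positivity) (G.energy_indicator_singleton_le hρ hδ h x)
  · rw [sqNorm_indicator_singleton]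
    exact (G.m_pos x).ne'
  · rw [sqNorm_indicator_singleton]
    exact (G.m_lt_top x).ne

omit [Countable X] [DiscreteMeasurableSpace X] in
theorem infinite_of_measure_univ_eq_top (hinf : G.m Set.univ = ∞) : Infinite X := by
  by_contra hX
  rw [not_infinite_iff_finite] at hX
  have := measure_biUnion_lt_top (μ := G.m) (s := Set.univ) (f := fun x : X => {x})
    Set.finite_univ fun x _ => G.m_lt_top x
  rw [Set.biUnion_of_singleton, hinf] at this
  exact this.ne rfl

theorem essSpecBottom_Lmax_le_two_div_sq (hinf : G.m Set.univ = ∞) (hρ : G.IsIntrinsic ρ)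
    (hδ : 0 < δ) (h : ∀ x y : X, G.toSimpleGraph.Adj x y → ρ x y ∈ Set.Icc δ 1) :
    essSpecBottom G.Lmax ≤ ((2 / δ ^ 2 : ℝ) : EReal) := by
  have := G.infinite_of_measure_univ_eq_top hinf
  -- Indicators of distinct points eventually vanish at any given vertex, so they are weakly null
  -- after normalization.
  let e := Infinite.natEmbedding X
  refine G.essSpecBottom_Lmax_le (f := fun k => ({e k} : Set X).indicator fun _ => 1)
    (fun k => ?_) (fun k => ?_) (by positivity)
    (fun k => G.energy_indicator_singleton_le hρ hδ h (e k)) fun x => ?_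
  · rw [sqNorm_indicator_singleton]
    exact (G.m_pos _).ne'
  · rw [sqNorm_indicator_singleton]
    exact (G.m_lt_top _).ne
  · refine tendsto_const_nhds.congr' ?_
    have hne : ∀ᶠ k in atTop, x ≠ e k := by
      by_cases hx : ∃ n, e n = x
      · obtain ⟨n, rfl⟩ := hx
        filter_upwards [eventually_gt_atTop n] with k hk hk'
        exact hk.ne (e.injective hk')
      · exact Eventually.of_forall fun k hk => hx ⟨k, hk.symm⟩
    filter_upwards [hne] with k hk
    rw [Set.indicator_of_notMem (by simpa using hk), mul_zero]

end Single

end WeightedGraph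

theorem jumpBound_coe (δ a : ℝ) : jumpBound δ a = ((2 * ((Real.exp (a / 2) - 1) ^ 2 /
    (δ ^ 2 * Real.exp (2 * (a / 2)) + 1)) : ℝ) : EReal) := by
  rw [jumpBound, if_neg (EReal.coe_ne_top a), EReal.toReal_coe, mul_div_assoc,
    mul_div_cancel₀ a two_ne_zero]

end

theorem theorem4 {X : Type*} [Countable X] [MeasurableSpace X] [DiscreteMeasurableSpace X]
    (G : WeightedGraph X) (hconn : G.toSimpleGraph.Connected) (hinf : G.m Set.univ = ∞)
    (ρ : PseudoMetric X ℝ) (hρ : G.IsIntrinsic ρ) (x₀ : X) :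
    (specBottom G.Lmax ≤ G.minVolGrowth ρ ^ 2 / 4 ∧
      essSpecBottom G.Lmax ≤ G.volGrowth ρ x₀ ^ 2 / 4) ∧
    ∀ δ : ℝ, 0 ≤ δ → δ ≤ 1 →
      (∀ x y : X, G.toSimpleGraph.Adj x y → ρ x y ∈ Set.Icc δ 1) →
      specBottom G.Lmax ≤ jumpBound δ (G.minVolGrowth ρ) ∧
        essSpecBottom G.Lmax ≤ jumpBound δ (G.volGrowth ρ x₀) := by
  have hK₁ : ∀ α : ℝ, 0 ≤ α ^ 2 / 2 := fun α => by positivity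
  have hK₁c : Continuous fun α : ℝ => α ^ 2 / 2 := by fun_prop
  have h₁ : ∀ α > 0, ∀ x y, G.toSimpleGraph.Adj x y → (Real.exp (α * ρ x y) - 1) ^ 2 ≤
      α ^ 2 / 2 * ρ x y ^ 2 * (Real.exp (2 * (α * ρ x y)) + 1) := fun α _ x y _ =>
    (exp_sub_one_sq_le _).trans_eq (by ring)
  -- The general bound is `2 K(a/2)` for `K(α) = α²/2`.
  have hval : ∀ a : ℝ, 2 * ((a / 2) ^ 2 / 2) = a ^ 2 / 4 := fun a => by ring
  refine ⟨⟨?_, ?_⟩, fun δ hδ _ hadj => ?_⟩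
  · obtain ⟨a, ha, hvol⟩ | hvol := EReal.eq_coe_or_eq_top_of_nonneg (G.minVolGrowth_nonneg ρ)
    · rw [hvol, EReal.coe_sq_div_four, ← hval]
      exact G.specBottom_Lmax_le_of_minVolGrowth_eq hρ hK₁ hK₁c h₁ ha hvol
    · rw [hvol, EReal.top_sq_div_four]
      exact le_top
  · obtain ⟨a, ha, hvol⟩ | hvol := EReal.eq_coe_or_eq_top_of_nonneg (G.volGrowth_nonneg ρ x₀ hinf)
    · rw [hvol, EReal.coe_sq_div_four, ← hval]
      exact G.essSpecBottom_Lmax_le_of_volGrowth_eq hinf hρ hK₁ hK₁c h₁ ha hvol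
    · rw [hvol, EReal.top_sq_div_four]
      exact le_top
  -- With this `K`, `2 K(a/2)` is the finite value of `jumpBound δ a`.
  set K : ℝ → ℝ := fun α => (Real.exp α - 1) ^ 2 / (δ ^ 2 * Real.exp (2 * α) + 1)
  have hK : ∀ α : ℝ, 0 ≤ K α := fun α => by positivity
  have hKc : Continuous K := Continuous.div (by fun_prop) (by fun_prop) fun α => by positivity
  have h : ∀ α > 0, ∀ x y, G.toSimpleGraph.Adj x y → (Real.exp (α * ρ x y) - 1) ^ 2 ≤
      K α * ρ x y ^ 2 * (Real.exp (2 * (α * ρ x y)) + 1) := fun α hα x y hxy =>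
    exp_mul_sub_one_sq_le hα.le hδ (hadj x y hxy)
  have htop : jumpBound δ ⊤ = if δ = 0 then ⊤ else ((2 / δ ^ 2 : ℝ) : EReal) := if_pos rfl
  constructor
  · obtain ⟨a, ha, hvol⟩ | hvol := EReal.eq_coe_or_eq_top_of_nonneg (G.minVolGrowth_nonneg ρ)
    · rw [hvol, jumpBound_coe]
      exact G.specBottom_Lmax_le_of_minVolGrowth_eq hρ hK hKc h ha hvol
    · rw [hvol, htop]
      split_ifs with h0
      · exact le_top
      · exact G.specBottom_Lmax_le_two_div_sq hρ (hδ.lt_of_ne' h0) hadj x₀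
  · obtain ⟨a, ha, hvol⟩ | hvol := EReal.eq_coe_or_eq_top_of_nonneg (G.volGrowth_nonneg ρ x₀ hinf)
    · rw [hvol, jumpBound_coe]
      exact G.essSpecBottom_Lmax_le_of_volGrowth_eq hinf hρ hK hKc h ha hvol
    · rw [hvol, htop]
      split_ifs with h0
      · exact le_top
      · exact G.essSpecBottom_Lmax_le_two_div_sq hinf hρ (hδ.lt_of_ne' h0) hadj
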